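/- All digraphs are reflexive and have vertex set $\{0,\dots,k\}$ or $\{0,\dots,n-1\}$ as follows. A *path of length $k$* ($k\ge 0$) is a digraph on $\{0,1,\dots,k\}$ in which, for each $0\le i<k$, at least one of the arcs $(i,i+1)$, $(i+1,i)$ is present, and which has no other arcs besides the loops. For $n\ge 3$, an *$n$-cycle* is a digraph on $\{0,\dots,n-1\}$ in which, for each $i$ (indices modulo $n$), at least one of the arcs $(i,i+1)$, $(i+1,i)$ is present, and which has no other arcs besides the loops. An $n$-cycle $\mathbb G$ *satisfies the path condition* if there are no paths $\mathbb Q_1,\dots,\mathbb Q_m$ ($m\ge 1$) of length $n-2$, each isomorphic to an induced subdigraph of $\mathbb G$, that admit a surjective homomorphism $\prod_{i=1}^m\mathbb Q_i\to\mathbb G$ (arcs of the product are taken coordinatewise; homomorphisms preserve arcs); otherwise it *fails* the path condition. A cycle is *almost symmetric* if it has exactly one non-symmetric edge, i.e. exactly one arc $(x,y)$ such that $(y,x)$ is not an arc. The word $w(\mathbb S)$ of a path $\mathbb S$ of length $s$ is the word $x_1\cdots x_s$ over $\{+,-,*\}$ with $x_i=*$ if both $(i-1,i)$ and $(i,i-1)$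 are arcs, $x_i=+$ if only $(i-1,i)$ is, and $x_i=-$ if only $(i,i-1)$ is. The path $\mathbb S$ is *self-dual* if $w(\mathbb S)$ is unchanged when it is reversed and $+$ and $-$ are exchanged. Conversely, a word $x_1\cdots x_n$ with $n\ge3$ defines an $n$-cycle $C(x_1\cdots x_n)$ in which $x_i$ describes in the same way the arcs between $i-1$ and $i$ modulo $n$. **Theorem.** Let $\mathbb G$ be an $n$-cycle with $n\ge 4$. Then $\mathbb G$ fails the path condition if and only if $\mathbb G$ is almost symmetric or there exist a self-dual path $\mathbb S$ (possibly of length $0$) and an integer $k\ge 1$ such that $\mathbb G$ is isomorphic to $C\big((w(\mathbb S)\,{*}{*})^k\,w(\mathbb S)\,{+}\big)$. The "if" direction also holds for $n=3$. -/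

import Mathlib

namespace CycleWords

/-- The product of a family of digraphs: arcs are taken coordinatewise. -/
def prodDigraph {ι : Type*} {V : ι → Type*} (Q : ∀ i, Digraph (V i)) : Digraph (∀ i, V i) where
  Adj x y := ∀ i, (Q i).Adj (x i) (y i)

/-- A reflexive path of length `k`: between consecutive vertices at least one of the two
possible arcs is present, and apart from the loops there are no other arcs. -/
structure IsPath {k : ℕ} (P : Digraph (Fin (k + 1))) : Prop where
  refl : ∀ i, P.Adj i i
  consec : ∀ i : Fin k, P.Adj i.castSucc i.succ ∨ P.Adj i.succ i.castSucc
  noOther : ∀ i j, P.Adj i j → i = j ∨ i.val + 1 = j.val ∨ j.val + 1 = i.val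

/-- `j` is the vertex that follows `i` in the cyclic order `0, 1, …, n - 1, 0`. -/
def CyclicSucc {n : ℕ} (i j : Fin n) : Prop := j.val = (i.val + 1) % n

/-- A reflexive `n`-cycle (used for `3 ≤ n`): between cyclically consecutive vertices at least
one of the two possible arcs is present, and apart from the loops there are no other arcs. -/
structure IsCycle {n : ℕ} (G : Digraph (Fin n)) : Prop where
  refl : ∀ i, G.Adj i i
  consec : ∀ i j, CyclicSucc i j → G.Adj i j ∨ G.Adj j i
  noOther : ∀ i j, G.Adj i j → i = j ∨ CyclicSucc i j ∨ CyclicSucc j i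

/-- `H` is isomorphic to an induced subdigraph of `G`. -/
def Embeds {V W : Type*} (H : Digraph V) (G : Digraph W) : Prop :=
  Nonempty (H.Adj ↪r G.Adj)

/-- The two digraphs are isomorphic. -/
def Isomorphic {V W : Type*} (H : Digraph V) (G : Digraph W) : Prop :=
  Nonempty (H.Adj ≃r G.Adj)

/-- The path condition for a digraph `G` with `n` vertices: there is no surjective homomorphism
onto `G` from a product of (finitely many) paths of length `n - 2` that embed in `G`. -/
def PathCondition {n : ℕ} (G : Digraph (Fin n)) : Prop :=
  ¬ ∃ (m : ℕ) (Q : Fin m → Digraph (Fin (n - 2 + 1))),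
      0 < m ∧ (∀ i, IsPath (Q i) ∧ Embeds (Q i) G) ∧
      ∃ f : (prodDigraph Q).Adj →r G.Adj, Function.Surjective f

/-- Exactly one edge is not symmetric, that is, exactly one arc has no reverse arc. -/
def AlmostSymmetric {n : ℕ} (G : Digraph (Fin n)) : Prop :=
  ∃! e : Fin n × Fin n, G.Adj e.1 e.2 ∧ ¬ G.Adj e.2 e.1

/-- The alphabet `{+, -, *}`: forward arc, backward arc, symmetric edge. -/
inductive Letter : Type
  | plus : Letter
  | minus : Letter
  | star : Letter

/-- The involution of the alphabet that exchanges `+` and `-`. -/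
def Letter.bar : Letter → Letter
  | .plus => .minus
  | .minus => .plus
  | .star => .star

/-- The letter allows the forward direction. -/
def Letter.Fwd : Letter → Prop
  | .plus => True
  | .minus => False
  | .star => True

/-- The letter allows the backward direction. -/
def Letter.Bwd : Letter → Prop
  | .plus => False
  | .minus => True
  | .star => True

/-- The involution of words: reverse the word and exchange `+` and `-`. -/
def barWord (W : List Letter) : List Letter := (W.map Letter.bar).reverse

/-- `W` repeated `k` times. -/
def powWord (W : List Letter) (k : ℕ) : List Letter := (List.replicate k W).flatten

open Classical in
/-- The word of a path: its letter number `i` (from `0`) describes the arcs between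
the vertices `i` and `i + 1`. -/
noncomputable def pathWord {k : ℕ} (P : Digraph (Fin (k + 1))) : List Letter :=
  List.ofFn fun i : Fin k =>
    if P.Adj i.castSucc i.succ then
      if P.Adj i.succ i.castSucc then Letter.star else Letter.plus
    else Letter.minus

/-- A path is self-dual if its word is fixed by the involution. -/
def SelfDual {k : ℕ} (P : Digraph (Fin (k + 1))) : Prop := pathWord P = barWord (pathWord P)

/-- The reflexive cycle `C(W)` of a word `W`: its letter number `i` (from `0`) describes the arcs
between the vertex `i` and the vertex that follows it cyclically. -/
def cycleOfWord (W : List Letter) : Digraph (Fin W.length) where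
  Adj i j := i = j ∨ (CyclicSucc i j ∧ (W.get i).Fwd) ∨ (CyclicSucc j i ∧ (W.get j).Bwd)

/-- The word `(S**)^k S+` of a path `S`. -/
noncomputable def starWord {s : ℕ} (S : Digraph (Fin (s + 1))) (k : ℕ) : List Letter :=
  powWord (pathWord S ++ [Letter.star, Letter.star]) k ++ pathWord S ++ [Letter.plus]

/-- `G` is almost symmetric, or (up to isomorphism, that is, up to the choice of a starting point
and a direction) `G = (S**)^k S+` for a self-dual path `S` and a positive integer `k`. -/
def HasSpecialForm {n : ℕ} (G : Digraph (Fin n)) : Prop :=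
  AlmostSymmetric G ∨
    ∃ (s : ℕ) (S : Digraph (Fin (s + 1))) (k : ℕ),
      IsPath S ∧ SelfDual S ∧ 1 ≤ k ∧ Isomorphic G (cycleOfWord (starWord S k))

end CycleWords

/-! A cycle is unrolled to a digraph on `ℤ` with periodic letters; its paths of length `n - 2` are
the factors of length `n - 2` of the periodic word, read in either direction.

Only if: for `n ≥ 4` a homomorphism from a product of such paths to the cycle lifts to the unrolled
cycle. If it is surjective, its lift goes up by at least `n - 1` along some walk of the product, and
so there is a factor `R` of length `n - 1` such that every pattern of signs that contains all
factors of length `n - 2`, in both directions, also contains `R`. An adversary chooses a direction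
for every symmetric letter of `R` and then avoids `R` as long as possible; some factor of length
`n - 2` obstructs this. Counting letters shows that, for a suitable choice, it arises from `R` by
contracting two adjacent symmetric letters `**` to a single letter `z`. Comparing the result with
the cyclic word shows that for each run of symmetric letters and each `z` at most one position of
`**` is possible. If the directions alternate in each run, with the parities chosen according to
these positions, the adversary fails only if both signs `z` occur at the same position, and then the
two resulting conjugacies of words force `R = (U**)^k U` with `U` self-dual, since commuting words
are powers of a common word.

If: when the cyclic word is `S**Ty` and both `S+T` and `S-T` are, up to reversal, factors, the
product of these two contracted paths can be folded onto the cycle. -/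

namespace CycleWords

/-! ### Words and patterns -/

/-- The letter allows a step in the given direction, where `true` is forward. -/
def Letter.allows : Letter → Bool → Bool
  | .plus, c => c
  | .minus, c => !c
  | .star, _ => true

/-- The non-symmetric letter with the given direction. -/
def Letter.ofBool : Bool → Letter
  | true => .plus
  | false => .minus

/-- The direction of a non-symmetric letter. -/
def Letter.dir? : Letter → Option Bool
  | .plus => some true
  | .minus => some false
  | .star => none

/-- The directions of the non-symmetric letters of a word, in order. -/
def dirs (W : List Letter) : List Bool := W.filterMap Letter.dir?

/-- The word of `m` symmetric letters. -/
abbrev stars (m : ℕ) : List Letter := List.replicate m Letter.star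

/-- A sequence of directions (a pattern) contains the word `W` if the letters of `W` allow, one
by one, the directions of some subsequence: a path of word `W` can be traversed by a walk which
follows the pattern and may also stand still. -/
def Contains (W : List Letter) (p : List Bool) : Prop :=
  List.SublistForall₂ (fun (l : Letter) c => l.allows c) W p

theorem Letter.eq_star_or_ofBool (l : Letter) : l = .star ∨ ∃ b, l = .ofBool b := by
  cases l
  · exact Or.inr ⟨true, rfl⟩
  · exact Or.inr ⟨false, rfl⟩
  · exact Or.inl rfl

@[simp] theorem Letter.ofBool_ne_star (b : Bool) : Letter.ofBool b ≠ .star := by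
  cases b <;> simp [Letter.ofBool]

@[simp] theorem Letter.star_ne_ofBool (b : Bool) : Letter.star ≠ .ofBool b :=
  (Letter.ofBool_ne_star b).symm

@[simp] theorem Letter.ofBool_inj {b c : Bool} : Letter.ofBool b = .ofBool c ↔ b = c := by
  cases b <;> cases c <;> simp [Letter.ofBool]

@[simp] theorem Letter.allows_star (c : Bool) : Letter.star.allows c := rfl

@[simp] theorem Letter.allows_ofBool {b c : Bool} : (Letter.ofBool b).allows c ↔ b = c := by
  cases b <;> cases c <;> simp [Letter.ofBool, Letter.allows]

@[simp] theorem Letter.bar_star : Letter.star.bar = .star := rfl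

@[simp] theorem Letter.bar_ofBool (b : Bool) : (Letter.ofBool b).bar = .ofBool (!b) := by
  cases b <;> rfl

@[simp] theorem Letter.bar_bar (l : Letter) : l.bar.bar = l := by cases l <;> rfl

theorem Letter.allows_bar (l : Letter) (c : Bool) : l.bar.allows c = l.allows (!c) := by
  cases l <;> cases c <;> rfl

@[simp] theorem dirs_nil : dirs [] = [] := rfl

@[simp] theorem dirs_star_cons (W : List Letter) : dirs (.star :: W) = dirs W := rfl

@[simp] theorem dirs_ofBool_cons (b : Bool) (W : List Letter) :
    dirs (.ofBool b :: W) = b :: dirs W := by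
  cases b <;> rfl

@[simp] theorem dirs_append (V W : List Letter) : dirs (V ++ W) = dirs V ++ dirs W :=
  List.filterMap_append

@[simp] theorem dirs_stars (m : ℕ) : dirs (stars m) = [] := by
  induction m with
  | zero => rfl
  | succ m ih => rwa [stars, List.replicate_succ, dirs_star_cons]

theorem eq_stars_of_dirs_eq_nil : ∀ {W : List Letter}, dirs W = [] → W = stars W.length
  | [], _ => rfl
  | l :: W, h => by
    rcases l.eq_star_or_ofBool with rfl | ⟨b, rfl⟩
    · exact congrArg (Letter.star :: ·) (eq_stars_of_dirs_eq_nil h)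
    · simp at h

@[simp] theorem barWord_append (V W : List Letter) :
    barWord (V ++ W) = barWord W ++ barWord V := by
  simp [barWord]

theorem barWord_cons (l : Letter) (W : List Letter) : barWord (l :: W) = barWord W ++ [l.bar] := by
  simp [barWord]

theorem barWord_singleton (l : Letter) : barWord [l] = [l.bar] := rfl

@[simp] theorem barWord_barWord (W : List Letter) : barWord (barWord W) = W := by
  have : Letter.bar ∘ Letter.bar = id := by funext l; simp
  simp [barWord, List.map_reverse, this]

@[simp] theorem length_barWord (W : List Letter) : (barWord W).length = W.length := by
  simp [barWord]

theorem dirs_barWord (W : List Letter) : dirs (barWord W) = ((dirs W).map (!·)).reverse := by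
  induction W with
  | nil => rfl
  | cons l W ih => rcases l.eq_star_or_ofBool with rfl | ⟨b, rfl⟩ <;> simp [barWord_cons, ih]

theorem contains_iff {W : List Letter} {p : List Bool} :
    Contains W p ↔
      ∃ s : List Bool, List.Forall₂ (fun (l : Letter) c => l.allows c) W s ∧ s.Sublist p :=
  List.sublistForall₂_iff

theorem Contains.mono {W : List Letter} {p p' : List Bool} (h : Contains W p)
    (hp : p.Sublist p') : Contains W p' :=
  let ⟨s, hW, hs⟩ := contains_iff.1 h
  contains_iff.2 ⟨s, hW, hs.trans hp⟩

theorem Contains.append {V W : List Letter} {p r : List Bool} (hV : Contains V p)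
    (hW : Contains W r) : Contains (V ++ W) (p ++ r) :=
  let ⟨s, hV, hs⟩ := contains_iff.1 hV
  let ⟨t, hW, ht⟩ := contains_iff.1 hW
  contains_iff.2 ⟨s ++ t, List.rel_append hV hW, hs.append ht⟩

theorem Contains.of_append_append {U V W : List Letter} {p : List Bool}
    (h : Contains (U ++ V ++ W) p) :
    Contains V p := by
  obtain ⟨s, h, hs⟩ := contains_iff.1 h
  refine contains_iff.2 ⟨(s.drop U.length).take V.length, ?_,
    ((List.take_sublist _ _).trans (List.drop_sublist _ _)).trans hs⟩
  have := List.forall₂_take V.length (List.forall₂_drop U.length h)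
  rwa [List.append_assoc, List.drop_left, List.take_left] at this

theorem Contains.of_cons_cons {l : Letter} {W : List Letter} {c : Bool} {p : List Bool}
    (h : Contains (l :: W) (c :: p)) : Contains W p := by
  cases h with
  | cons _ h => exact h
  | cons_right h => exact Contains.of_append_append (U := [l]) (W := []) (by rwa [List.append_nil])

/-! ### Avoiding a word as long as possible -/

/-- A letter of a word together with, for a symmetric letter, a chosen direction. -/
inductive OrientedLetter : Type
  | star (c : Bool) : OrientedLetter
  | dir (b : Bool) : OrientedLetter

/-- The underlying letter, which forgets the direction chosen for a symmetric letter. -/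
def OrientedLetter.letter : OrientedLetter → Letter
  | .star _ => .star
  | .dir b => .ofBool b

/-- The underlying word. -/
def letters (L : List OrientedLetter) : List Letter := L.map OrientedLetter.letter

@[simp] theorem letters_nil : letters [] = [] := rfl

@[simp] theorem letters_star_cons (c : Bool) (L : List OrientedLetter) :
    letters (.star c :: L) = .star :: letters L := rfl

@[simp] theorem letters_dir_cons (b : Bool) (L : List OrientedLetter) :
    letters (.dir b :: L) = .ofBool b :: letters L := rfl

@[simp] theorem letters_append (L M : List OrientedLetter) :
    letters (L ++ M) = letters L ++ letters M := by
  simp [letters]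

@[simp] theorem letters_replicate_star (j : ℕ) (c : Bool) :
    letters (List.replicate j (.star c)) = stars j := by
  simp [letters, OrientedLetter.letter]

@[simp] theorem length_letters (L : List OrientedLetter) : (letters L).length = L.length := by
  simp [letters]

/-- A pattern that avoids the word `letters L` as long as possible: before a non-symmetric letter
is matched, the opposite direction is repeated `N` times; a symmetric letter is matched by the
chosen direction; the last letter is not matched. -/
def avoidingPattern (N : ℕ) : List OrientedLetter → List Bool
  | [] => []
  | .star c :: L => if L = [] then [] else c :: avoidingPattern N L
  | .dir b :: L => List.replicate N (!b) ++ if L = [] then [] else b :: avoidingPattern N L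

/-- The greedy matching of a word into `avoidingPattern N L` succeeds for large `N`. -/
def Fits : List OrientedLetter → List Letter → Prop
  | [], _ => False
  | .star _ :: _, [] => True
  | .star c :: L, l :: q => (l.allows c ∧ Fits L q) ∨ (¬ l.allows c ∧ Fits L (l :: q))
  | .dir b :: L, q => (∀ l ∈ q, l.allows (!b)) ∨
      ∃ s q', q = s ++ .ofBool b :: q' ∧ (∀ l ∈ s, l.allows (!b)) ∧ Fits L q'

theorem not_contains_cons_nil (l : Letter) (W : List Letter) : ¬ Contains (l :: W) [] := nofun

theorem Contains.of_replicate_append {N : ℕ} {b : Bool} {W : List Letter} {p : List Bool}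
    (h : Contains (.ofBool b :: W) (List.replicate N (!b) ++ p)) :
    Contains (.ofBool b :: W) p := by
  induction N with
  | zero => exact h
  | succ N ih =>
    rw [List.replicate_succ, List.cons_append] at h
    cases h with
    | cons hb _ => simp at hb
    | cons_right h => exact ih h

theorem not_contains_avoidingPattern (N : ℕ) :
    ∀ L : List OrientedLetter, L ≠ [] → ¬ Contains (letters L) (avoidingPattern N L)
  | [], h => absurd rfl h
  | .star c :: L, _ => fun h => by
    rw [avoidingPattern] at h
    split_ifs at h with hL
    · exact not_contains_cons_nil _ _ h
    · exact not_contains_avoidingPattern N L hL h.of_cons_cons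
  | .dir b :: L, _ => fun h => by
    rw [avoidingPattern, letters_dir_cons] at h
    replace h := h.of_replicate_append
    split_ifs at h with hL
    · exact not_contains_cons_nil _ _ h
    · exact not_contains_avoidingPattern N L hL h.of_cons_cons

theorem contains_replicate {N : ℕ} {c : Bool} {q : List Letter} (hq : q.length ≤ N)
    (h : ∀ l ∈ q, l.allows c) : Contains q (List.replicate N c) := by
  refine contains_iff.2 ⟨List.replicate q.length c, ?_, List.replicate_sublist_replicate c |>.2 hq⟩
  rw [List.forall₂_iff_get]
  exact ⟨by simp, fun i h₁ h₂ => by simpa using h _ (List.getElem_mem h₁)⟩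

theorem Fits.ne_nil {L : List OrientedLetter} {q : List Letter} (h : Fits L q) : L ≠ [] := by
  rintro rfl
  exact h

theorem Fits.contains {N : ℕ} : ∀ {L : List OrientedLetter} {q : List Letter}, q.length ≤ N →
    Fits L q → Contains q (avoidingPattern N L)
  | [], _, _, h => h.elim
  | .star _ :: _, [], _, _ => .nil
  | .star c :: L, l :: q, hq, .inl ⟨hl, h⟩ => by
    rw [avoidingPattern, if_neg h.ne_nil]
    exact .cons hl (h.contains (Nat.le_of_succ_le hq))
  | .star c :: L, l :: q, hq, .inr ⟨_, h⟩ => by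
    rw [avoidingPattern, if_neg h.ne_nil]
    exact .cons_right (h.contains hq)
  | .dir b :: L, q, hq, .inl h =>
    (contains_replicate hq h).mono (List.sublist_append_left _ _)
  | .dir b :: L, _, hq, .inr ⟨s, q', hsq, hs, h⟩ => by
    subst hsq
    rw [List.length_append, List.length_cons] at hq
    rw [avoidingPattern, if_neg h.ne_nil]
    exact (contains_replicate (by omega) hs).append
      (.cons (Letter.allows_ofBool.2 rfl) (h.contains (by omega)))

theorem forall_allows_or_exists_eq_append (b : Bool) (q : List Letter) :
    (∀ l ∈ q, l.allows (!b)) ∨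
      ∃ s q', q = s ++ .ofBool b :: q' ∧ ∀ l ∈ s, l.allows (!b) := by
  induction q with
  | nil => exact Or.inl nofun
  | cons l q ih =>
    by_cases hl : l.allows (!b)
    · rcases ih with ih | ⟨s, q', rfl, hs⟩
      · exact Or.inl (List.forall_mem_cons.2 ⟨hl, ih⟩)
      · exact Or.inr ⟨l :: s, q', rfl, List.forall_mem_cons.2 ⟨hl, hs⟩⟩
    · obtain rfl : l = .ofBool b := by
        cases l <;> cases b <;> simp_all [Letter.allows, Letter.ofBool]
      exact Or.inr ⟨[], q, rfl, nofun⟩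

theorem exists_of_not_fits_dir {b : Bool} {L : List OrientedLetter} {q : List Letter}
    (h : ¬ Fits (.dir b :: L) q) :
    ∃ s q', q = s ++ .ofBool b :: q' ∧ (∀ l ∈ s, l.allows (!b)) ∧ ¬ Fits L q' := by
  rw [Fits, not_or] at h
  obtain ⟨s, q', rfl, hs⟩ := (forall_allows_or_exists_eq_append b q).resolve_left h.1
  exact ⟨s, q', rfl, hs, fun hf => h.2 ⟨s, q', rfl, hs, hf⟩⟩

/-! ### Words that do not fit -/

/-- A symmetric letter followed by a non-symmetric one has the direction of the latter. -/
def Coherent (L : List OrientedLetter) : Prop :=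
  L.IsChain fun B B' => ∀ c b, B = .star c → B' = .dir b → c = b

theorem Coherent.tail {B : OrientedLetter} {L : List OrientedLetter} (h : Coherent (B :: L)) :
    Coherent L :=
  List.IsChain.tail h

theorem Coherent.eq {c b : Bool} {L : List OrientedLetter}
    (h : Coherent (.star c :: .dir b :: L)) : c = b :=
  (List.isChain_cons_cons.1 h).1 c b rfl rfl

/-- The second word arises from the first one by inserting symmetric letters. -/
structure StarExpansion (W q : List Letter) : Prop where
  sublist : W.Sublist q
  dirs_eq : dirs q = dirs W

/-- The number of symmetric letters at the end of a word. -/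
def trail : List Letter → ℕ
  | [] => 0
  | l :: q => if dirs (l :: q) = [] then trail q + 1 else trail q

theorem trail_star_cons (W : List Letter) :
    trail (.star :: W) = if dirs W = [] then trail W + 1 else trail W := rfl

theorem trail_ofBool_cons (b : Bool) (W : List Letter) : trail (.ofBool b :: W) = trail W :=
  if_neg (by simp)

theorem trail_append_of_ne {V W : List Letter} (h : dirs W ≠ []) : trail (V ++ W) = trail W := by
  induction V with
  | nil => rfl
  | cons l V ih =>
    rw [List.cons_append, trail, if_neg, ih]
    rw [← List.cons_append, dirs_append]
    exact List.append_ne_nil_of_right_ne_nil _ h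

theorem trail_append_stars (W : List Letter) (d : ℕ) : trail (W ++ stars d) = trail W + d := by
  induction W with
  | nil =>
    induction d with
    | zero => rfl
    | succ d ih =>
      rw [List.nil_append] at ih ⊢
      rw [stars, List.replicate_succ, trail_star_cons, if_pos (dirs_stars d), ih, add_assoc]
  | cons l W ih =>
    have : dirs (l :: (W ++ stars d)) = dirs (l :: W) := by
      rw [← List.cons_append, dirs_append, dirs_stars, List.append_nil]
    rw [List.cons_append, trail, trail, this, ih]
    split_ifs <;> omega

theorem trail_le_trail_cons (l : Letter) (W : List Letter) : trail W ≤ trail (l :: W) := by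
  rw [trail]
  split_ifs <;> omega

namespace StarExpansion

variable {W q : List Letter}

theorem length_le (h : StarExpansion W q) : W.length ≤ q.length := h.sublist.length_le

theorem eq_of_length_le (h : StarExpansion W q) (hq : q.length ≤ W.length) : q = W :=
  (h.sublist.eq_of_length_le hq).symm

protected theorem append {W' q' : List Letter} (h : StarExpansion W q)
    (h' : StarExpansion W' q') : StarExpansion (W ++ W') (q ++ q') :=
  ⟨h.sublist.append h'.sublist, by rw [dirs_append, dirs_append, h.dirs_eq, h'.dirs_eq]⟩

protected theorem cons (l : Letter) (h : StarExpansion W q) : StarExpansion (l :: W) (l :: q) :=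
  .append (W := [l]) (q := [l]) ⟨.refl _, rfl⟩ h

protected theorem nil (hq : dirs q = []) : StarExpansion [] q := ⟨q.nil_sublist, hq⟩

theorem trail_le (h : StarExpansion W q) : trail W ≤ trail q := by
  obtain ⟨hs, hd⟩ := h
  induction hs with
  | slnil => rfl
  | @cons W q l hs ih =>
    have hl := (hs.filterMap Letter.dir?).length_le
    refine (ih ?_).trans (trail_le_trail_cons l q)
    rcases l.eq_star_or_ofBool with rfl | ⟨b, rfl⟩
    · exact hd
    · rw [dirs_ofBool_cons] at hd
      have hd := congrArg List.length hd
      rw [List.length_cons] at hd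
      exact absurd (hd.trans_le hl) (Nat.not_succ_le_self _)
  | @cons_cons W q l _ ih =>
    rcases l.eq_star_or_ofBool with rfl | ⟨b, rfl⟩
    · have := ih hd
      rw [dirs_star_cons, dirs_star_cons] at hd
      rw [trail_star_cons, trail_star_cons, hd]
      split_ifs <;> omega
    · rw [trail_ofBool_cons, trail_ofBool_cons]
      exact ih (by simpa using hd)

end StarExpansion

theorem starExpansion_of_not_fits : ∀ {L : List OrientedLetter} {q : List Letter}, Coherent L →
    (dirs q).length ≤ (dirs (letters L)).length → ¬ Fits L q → StarExpansion (letters L) q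
  | [], q, _, hq, _ => .nil (List.length_eq_zero_iff.1 (Nat.le_zero.1 hq))
  | .star c :: L, [], _, _, h => (h trivial).elim
  | .star c :: L, l :: q, hL, hq, h => by
    simp only [Fits, not_or, not_and] at h
    rcases l.eq_star_or_ofBool with rfl | ⟨b, rfl⟩
    · exact (starExpansion_of_not_fits (q := q) hL.tail hq (h.1 rfl)).cons .star
    · exfalso
      rw [letters_star_cons, dirs_star_cons] at hq
      by_cases hb : b = c
      · subst hb
        rw [dirs_ofBool_cons, List.length_cons] at hq
        have := (starExpansion_of_not_fits hL.tail (by omega) (h.1 (by simp))).dirs_eq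
        rw [this] at hq
        omega
      · obtain ⟨hs, hd⟩ := starExpansion_of_not_fits hL.tail hq (h.2 (by simpa using hb))
        match L with
        | [] => simp at hd
        | .dir b' :: L =>
          rw [letters_dir_cons, dirs_ofBool_cons, dirs_ofBool_cons] at hd
          exact hb ((List.cons_eq_cons.1 hd).1.trans hL.eq.symm)
        | .star c' :: L =>
          have hs := (List.cons_sublist_cons'.1 hs).resolve_right
            fun h => Letter.star_ne_ofBool _ h.1
          have hl := (hs.filterMap Letter.dir?).length_le
          have hd := congrArg List.length hd
          rw [dirs_ofBool_cons, List.length_cons] at hd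
          exact absurd (hd.trans_le hl) (Nat.not_succ_le_self _)
  | .dir b :: L, q, hL, hq, h => by
    obtain ⟨s, q', rfl, -, h⟩ := exists_of_not_fits_dir h
    simp only [letters_dir_cons, dirs_append, dirs_ofBool_cons, List.length_append,
      List.length_cons] at hq
    have hD := starExpansion_of_not_fits hL.tail (by omega) h
    rw [hD.dirs_eq] at hq
    exact .append (.nil (List.length_eq_zero_iff.1 (by omega))) (hD.cons _)

theorem starExpansion_of_not_fits_ofBool_cons {z : Bool} {L : List OrientedLetter}
    {q : List Letter} (hL : Coherent L)
    (hq : (dirs q).length ≤ (dirs (letters L)).length + 1)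
    (h : ¬ Fits (.dir (!z) :: L) (.ofBool z :: q)) :
    StarExpansion (.ofBool (!z) :: letters L) q := by
  obtain ⟨s, q', hs, -, hf⟩ := exists_of_not_fits_dir h
  obtain ⟨⟨⟩, -⟩ | ⟨s, rfl, rfl⟩ := List.cons_eq_append_iff.1 hs
  · simp at hs
  · simp only [dirs_append, dirs_ofBool_cons, List.length_append, List.length_cons] at hq
    have hD := starExpansion_of_not_fits hL (by omega) hf
    rw [hD.dirs_eq] at hq
    exact .append (.nil (List.length_eq_zero_iff.1 (by omega))) (hD.cons _)

/-- The first loss: a symmetric letter of the avoided word is skipped by the greedy matching, since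
its direction is opposite to the non-symmetric letter which is to be matched. -/
theorem exists_loss_of_not_fits : ∀ {L : List OrientedLetter} {q : List Letter}, Coherent L →
    q.length + 1 ≤ L.length → (dirs q).length ≤ (dirs (letters L)).length + 1 → ¬ Fits L q →
    ∃ L₁ L₂ q₁ q₂ z, L = L₁ ++ .star (!z) :: L₂ ∧ q = q₁ ++ .ofBool z :: q₂ ∧
      StarExpansion (letters L₁) q₁ ∧ trail q₁ = trail (letters L₁) ∧
      ¬ Fits L₂ (.ofBool z :: q₂)
  | [], q, _, hl, _, _ => by simp at hl
  | .star c :: L, [], _, _, _, h => (h trivial).elim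
  | .star c :: L, l :: q, hL, hl, hq, h => by
    simp only [Fits, not_or, not_and] at h
    rw [List.length_cons, List.length_cons] at hl
    rcases l.eq_star_or_ofBool with rfl | ⟨b, rfl⟩
    · obtain ⟨L₁, L₂, q₁, q₂, z, rfl, rfl, h1, ht, h2⟩ :=
        exists_loss_of_not_fits (q := q) hL.tail (by omega) hq (h.1 rfl)
      refine ⟨.star c :: L₁, L₂, .star :: q₁, q₂, z, rfl, rfl, h1.cons _, ?_, h2⟩
      rw [letters_star_cons, trail_star_cons, trail_star_cons, h1.dirs_eq, ht]
    · by_cases hb : b = c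
      · subst hb
        rw [dirs_ofBool_cons, List.length_cons] at hq
        have := (starExpansion_of_not_fits hL.tail (Nat.le_of_succ_le_succ hq)
          (h.1 (by simp))).length_le
        rw [length_letters] at this
        omega
      · obtain rfl := Bool.eq_not_of_ne (Ne.symm hb)
        exact ⟨[], L, [], q, b, rfl, rfl, .nil rfl, rfl, h.2 (by simp)⟩
  | .dir b :: L, q, hL, hl, hq, h => by
    obtain ⟨s, q', rfl, -, h⟩ := exists_of_not_fits_dir h
    simp only [letters_dir_cons, dirs_append, dirs_ofBool_cons, List.length_append,
      List.length_cons] at hq hl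
    by_cases hs : dirs s = []
    · obtain ⟨L₁, L₂, q₁, q₂, z, rfl, rfl, h1, ht, h2⟩ :=
        exists_loss_of_not_fits hL.tail (by omega) (by omega) h
      refine ⟨.dir b :: L₁, L₂, s ++ .ofBool b :: q₁, q₂, z, rfl, by simp,
        .append (.nil hs) (h1.cons _), ?_, h2⟩
      rw [trail_append_of_ne (by simp), letters_dir_cons, trail_ofBool_cons, trail_ofBool_cons, ht]
    · have := List.length_pos_iff.2 hs
      have := (starExpansion_of_not_fits hL.tail (by omega) h).length_le
      rw [length_letters] at this
      omega

theorem exists_replicate_of_not_fits_ofBool_cons {z : Bool} :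
    ∀ {L : List OrientedLetter} {q : List Letter}, Coherent (.star (!z) :: L) →
    (dirs q).length ≤ (dirs (letters L)).length → ¬ Fits L (.ofBool z :: q) →
    ∃ j L', StarExpansion (letters L') q ∧
      (L = List.replicate j (.star (!z)) ++ L' ∨
        L = List.replicate j (.star (!z)) ++ .star z :: L')
  | [], q, _, hq, _ => ⟨0, [], .nil (List.length_eq_zero_iff.1 (Nat.le_zero.1 hq)), Or.inl rfl⟩
  | .star c :: L, q, hL, hq, h => by
    simp only [Fits, not_or, not_and] at h
    by_cases hz : z = c
    · subst hz
      exact ⟨0, L, starExpansion_of_not_fits hL.tail.tail hq (h.1 (by simp)), Or.inr rfl⟩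
    · obtain rfl := Bool.eq_not_of_ne (Ne.symm hz)
      obtain ⟨j, L', hD, rfl | rfl⟩ :=
        exists_replicate_of_not_fits_ofBool_cons hL.tail hq (h.2 (by simp))
      · exact ⟨j + 1, L', hD, Or.inl rfl⟩
      · exact ⟨j + 1, L', hD, Or.inr rfl⟩
  | .dir b :: L, q, hL, hq, h => by
    obtain rfl := hL.eq
    rw [letters_dir_cons, dirs_ofBool_cons, List.length_cons] at hq
    exact ⟨0, .dir (!z) :: L, starExpansion_of_not_fits_ofBool_cons hL.tail.tail hq h, Or.inl rfl⟩

/-- In the second case the loss costs two symmetric letters, but the symmetric letters around them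
still bound the ones around the additional non-symmetric letter. -/
theorem eq_or_double_loss_of_not_fits {L : List OrientedLetter} {q : List Letter} (hL : Coherent L)
    (hl : q.length + 1 ≤ L.length) (hq : (dirs q).length ≤ (dirs (letters L)).length + 1)
    (h : ¬ Fits L q) :
    ∃ L₁ L₂ q₁ q₂ z c, L = L₁ ++ .star (!z) :: .star c :: L₂ ∧ q = q₁ ++ .ofBool z :: q₂ ∧
      dirs q₁ = dirs (letters L₁) ∧ dirs q₂ = dirs (letters L₂) ∧
      ((q₁ = letters L₁ ∧ q₂ = letters L₂) ∨
        (c = !z ∧ (∃ c' L₃, L₂ = .star c' :: L₃) ∧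
          StarExpansion (letters L₁) q₁ ∧ trail q₁ = trail (letters L₁) ∧
          (dirs (letters L₂) ≠ [] → trail (letters L₂) ≤ trail q₂))) := by
  obtain ⟨L₁, L₂, q₁, q₂, z, rfl, rfl, h1, ht, h2⟩ := exists_loss_of_not_fits hL hl hq h
  have hl1 := h1.length_le
  simp only [List.length_append, List.length_cons, letters_append, letters_star_cons, dirs_append,
    dirs_star_cons, dirs_ofBool_cons, h1.dirs_eq] at hl hq
  obtain ⟨j, L', hD, hj⟩ := exists_replicate_of_not_fits_ofBool_cons
    (List.isChain_append.1 hL).2.1 (by omega) h2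
  have hl2 := hD.length_le
  rw [length_letters] at hl1 hl2
  have exact {c : Bool} (e : L₂ = .star c :: L') :
      q₁ = letters L₁ ∧ q₂ = letters L' := by
    rw [e, List.length_cons] at hl
    exact ⟨h1.eq_of_length_le (by rw [length_letters]; omega),
      hD.eq_of_length_le (by rw [length_letters]; omega)⟩
  have trail_le {i : ℕ} {M : List OrientedLetter} (hM : letters M = stars i ++ letters L') :
      dirs q₂ = dirs (letters M) ∧ (dirs (letters M) ≠ [] → trail (letters M) ≤ trail q₂) := by
    rw [hM, dirs_append, dirs_stars, List.nil_append, hD.dirs_eq]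
    exact ⟨rfl, fun h0 => (trail_append_of_ne h0).trans_le hD.trail_le⟩
  rcases hj with rfl | rfl
  · match j with
    | 0 => simp at hl; omega
    | 1 => exact ⟨L₁, L', q₁, q₂, z, !z, rfl, rfl, h1.dirs_eq, hD.dirs_eq, Or.inl (exact rfl)⟩
    | j + 2 =>
      obtain ⟨hd, ht'⟩ := trail_le (M := .replicate (j + 1) (.star (!z)) ++ L') (i := j + 1)
        (by simp)
      exact ⟨L₁, _, q₁, q₂, z, !z, rfl, rfl, h1.dirs_eq, hd, Or.inr ⟨rfl, ⟨_, _, rfl⟩, h1, ht, ht'⟩⟩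
  · match j with
    | 0 => exact ⟨L₁, L', q₁, q₂, z, z, rfl, rfl, h1.dirs_eq, hD.dirs_eq, Or.inl (exact rfl)⟩
    | j + 1 =>
      obtain ⟨hd, ht'⟩ := trail_le (M := .replicate j (.star (!z)) ++ .star z :: L') (i := j + 1)
        (by simp [List.replicate_succ'])
      refine ⟨L₁, _, q₁, q₂, z, !z, rfl, rfl, h1.dirs_eq, hd, Or.inr ⟨rfl, ?_, h1, ht, ht'⟩⟩
      cases j <;> exact ⟨_, _, rfl⟩

/-! ### Rotations, heights and areas -/

theorem isRotated_iff_exists_append {α : Type*} {l l' : List α} :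
    l ~r l' ↔ ∃ u v, l = u ++ v ∧ l' = v ++ u := by
  constructor
  · rintro ⟨m, rfl⟩
    exact ⟨_, _, (List.take_append_drop (m % l.length) l).symm,
      List.rotate_eq_drop_append_take_mod⟩
  · rintro ⟨u, v, rfl, rfl⟩
    exact List.isRotated_append

theorem isRotated_barWord {V W : List Letter} (h : V ~r W) : barWord V ~r barWord W :=
  (h.map _).reverse

/-- The contribution of a letter to the height of a word. -/
def Letter.sgn : Letter → ℤ
  | .plus => 1
  | .minus => -1
  | .star => 0

/-- The number of forward letters minus the number of backward letters. -/
def height (W : List Letter) : ℤ := (W.map Letter.sgn).sum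

/-- The sum of the heights of all prefixes. -/
def area : List Letter → ℤ
  | [] => 0
  | l :: W => l.sgn * (W.length + 1) + area W

@[simp] theorem Letter.sgn_star : Letter.star.sgn = 0 := rfl

@[simp] theorem Letter.sgn_bar (l : Letter) : l.bar.sgn = -l.sgn := by cases l <;> rfl

theorem Letter.isUnit_sgn_ofBool (b : Bool) : IsUnit (Letter.ofBool b).sgn := by
  cases b <;> decide

theorem Letter.sgn_ofBool_not (b : Bool) :
    (Letter.ofBool (!b)).sgn = -(Letter.ofBool b).sgn := by
  cases b <;> rfl

@[simp] theorem height_nil : height [] = 0 := rfl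

@[simp] theorem height_cons (l : Letter) (W : List Letter) :
    height (l :: W) = l.sgn + height W := by
  simp [height]

@[simp] theorem height_append (V W : List Letter) : height (V ++ W) = height V + height W := by
  simp [height]

@[simp] theorem height_stars (m : ℕ) : height (stars m) = 0 := by simp [height]

theorem height_barWord (W : List Letter) : height (barWord W) = -height W := by
  induction W with
  | nil => rfl
  | cons l W ih => simp [barWord_cons, ih, add_comm]

theorem height_map_dirs (W : List Letter) : height ((dirs W).map Letter.ofBool) = height W := by
  induction W with
  | nil => rfl
  | cons l W ih => rcases l.eq_star_or_ofBool with rfl | ⟨b, rfl⟩ <;> simp [ih]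

theorem height_eq_of_dirs_eq {V W : List Letter} (h : dirs V = dirs W) : height V = height W := by
  rw [← height_map_dirs V, h, height_map_dirs]

theorem height_eq_of_isRotated {V W : List Letter} (h : V ~r W) : height V = height W :=
  (h.perm.map _).sum_eq

theorem abs_height_le (W : List Letter) : |height W| ≤ W.length := by
  induction W with
  | nil => rfl
  | cons l W ih =>
    have hl : |l.sgn| ≤ 1 := by cases l <;> decide
    have := abs_add_le l.sgn (height W)
    rw [height_cons, List.length_cons, Nat.cast_succ]
    omega

theorem area_append (V W : List Letter) :
    area (V ++ W) = area V + height V * W.length + area W := by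
  induction V with
  | nil => simp [area]
  | cons l V ih =>
    simp only [List.cons_append, area, ih, List.length_append, Nat.cast_add, height_cons]
    ring

@[simp] theorem powWord_zero (t : List Letter) : powWord t 0 = [] := rfl

@[simp] theorem powWord_one (t : List Letter) : powWord t 1 = t := by simp [powWord]

theorem powWord_succ (t : List Letter) (i : ℕ) : powWord t (i + 1) = t ++ powWord t i := by
  simp [powWord, List.replicate_succ]

theorem powWord_succ' (t : List Letter) (i : ℕ) : powWord t (i + 1) = powWord t i ++ t := by
  simp [powWord, List.replicate_succ']

theorem powWord_add (t : List Letter) (i j : ℕ) :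
    powWord t (i + j) = powWord t i ++ powWord t j := by
  rw [powWord, ← List.replicate_append_replicate, List.flatten_append]
  rfl

theorem height_powWord (t : List Letter) (i : ℕ) : height (powWord t i) = i * height t := by
  induction i with
  | zero => simp
  | succ i ih => rw [powWord_succ, height_append, ih]; push_cast; ring

theorem dirs_powWord_eq_nil {t : List Letter} (ht : dirs t = []) (i : ℕ) :
    dirs (powWord t i) = [] := by
  induction i with
  | zero => rfl
  | succ i ih => rw [powWord_succ, dirs_append, ht, ih, List.append_nil]

theorem exists_powWord_of_append_comm (u v : List Letter) (h : u ++ v = v ++ u) :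
    ∃ t i j, u = powWord t i ∧ v = powWord t j := by
  rcases eq_or_ne u [] with rfl | hu
  · exact ⟨v, 0, 1, rfl, (powWord_one v).symm⟩
  rcases eq_or_ne v [] with rfl | hv
  · exact ⟨u, 1, 0, (powWord_one u).symm, rfl⟩
  have _hu := List.length_pos_iff.2 hu
  have _hv := List.length_pos_iff.2 hv
  rcases List.append_eq_append_iff.1 h with ⟨w, hvw, hw⟩ | ⟨w, huw, hw⟩
  · have _hl : v.length = u.length + w.length := by simpa using congrArg List.length hvw
    obtain ⟨t, i, j, h1, h2⟩ := exists_powWord_of_append_comm u w (hvw.symm.trans hw)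
    exact ⟨t, i, i + j, h1, by rw [hvw, powWord_add, ← h1, ← h2]⟩
  · have _hl : u.length = v.length + w.length := by simpa using congrArg List.length huw
    obtain ⟨t, i, j, h1, h2⟩ := exists_powWord_of_append_comm w v (hw.symm.trans huw)
    exact ⟨t, j + i, j, by rw [huw, powWord_add, ← h1, ← h2], h2⟩
termination_by u.length + v.length
decreasing_by all_goals (simp_wf; omega)

theorem eq_nil_of_append_comm {u v : List Letter} (h : u ++ v = v ++ u)
    (hs : IsUnit (height (u ++ v))) : u = [] ∨ v = [] := by
  obtain ⟨t, i, j, rfl, rfl⟩ := exists_powWord_of_append_comm u v h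
  rw [← powWord_add, height_powWord] at hs
  have hij : i + j = 1 := Int.isUnit_iff_natAbs_eq.1 (isUnit_of_mul_isUnit_left hs)
  rcases Nat.add_eq_one_iff.1 hij with ⟨rfl, -⟩ | ⟨-, rfl⟩
  · exact Or.inl rfl
  · exact Or.inr rfl

theorem append_ofBool_inj : ∀ {X X' Y Y' : List Letter} {z z' : Bool},
    X ++ .ofBool z :: Y = X' ++ .ofBool z' :: Y' → (dirs X).length = (dirs X').length →
    X = X' ∧ Y = Y'
  | [], [], _, _, _, _, h, _ => by
    rw [List.nil_append, List.nil_append, List.cons.injEq] at h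
    exact ⟨rfl, h.2⟩
  | [], _ :: _, _, _, _, _, h, hd => by
    rw [List.nil_append, List.cons_append, List.cons.injEq] at h
    simp [← h.1] at hd
  | _ :: _, [], _, _, _, _, h, hd => by
    rw [List.nil_append, List.cons_append, List.cons.injEq] at h
    simp [h.1] at hd
  | l :: X, l' :: X', _, _, _, _, h, hd => by
    rw [List.cons_append, List.cons_append, List.cons.injEq] at h
    obtain ⟨rfl, h⟩ := h
    obtain ⟨rfl, rfl⟩ := append_ofBool_inj h (by
      rcases l.eq_star_or_ofBool with rfl | ⟨b, rfl⟩ <;> simpa using hd)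
    exact ⟨rfl, rfl⟩

/-- A rotation that moves a non-symmetric letter would make the sequence of non-symmetric letters a
proper power, which its height `1` or `-1` excludes. -/
theorem eq_stars_append_of_isRotated {q₁ q₂ r₁ r₂ : List Letter} {z : Bool}
    (h : q₁ ++ .ofBool z :: (q₂ ++ stars 2) ~r r₁ ++ .ofBool z :: (r₂ ++ stars 2))
    (h1 : dirs q₁ = dirs r₁) (h2 : dirs q₂ = dirs r₂)
    (hs : IsUnit (height (q₁ ++ .ofBool z :: q₂))) :
    ∃ k, (q₁ = stars k ++ r₁ ∧ r₂ = q₂ ++ stars k) ∨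
      (r₁ = stars k ++ q₁ ∧ q₂ = r₂ ++ stars k) := by
  have aux {q₁ q₂ r₁ r₂ v : List Letter} {k : ℕ} (h1 : dirs q₁ = dirs r₁)
      (hq : q₁ ++ .ofBool z :: (q₂ ++ stars 2) = stars k ++ v)
      (hr : r₁ ++ .ofBool z :: (r₂ ++ stars 2) = v ++ stars k) :
      q₁ = stars k ++ r₁ ∧ r₂ = q₂ ++ stars k := by
    have hc : (stars k ++ r₁) ++ .ofBool z :: (r₂ ++ stars 2) =
        q₁ ++ .ofBool z :: (q₂ ++ stars k ++ stars 2) := by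
      rw [List.append_assoc, hr, ← List.append_assoc, ← hq]
      simp only [List.append_assoc, List.cons_append, List.replicate_append_replicate, add_comm]
    obtain ⟨e1, e2⟩ := append_ofBool_inj hc (by simp [h1])
    exact ⟨e1.symm, List.append_cancel_right e2⟩
  obtain ⟨u, v, hu, hv⟩ := isRotated_iff_exists_append.1 h
  have hd : dirs u ++ dirs v = dirs v ++ dirs u := by
    rw [← dirs_append, ← dirs_append, ← hu, ← hv]
    simp [h1, h2]
  have hc := eq_nil_of_append_comm
    (u := (dirs u).map Letter.ofBool) (v := (dirs v).map Letter.ofBool)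
    (by rw [← List.map_append, hd, List.map_append])
    (by
      rw [← List.map_append, ← dirs_append, height_map_dirs, ← hu]
      simpa using hs)
  rw [List.map_eq_nil_iff, List.map_eq_nil_iff] at hc
  rcases hc with hc | hc <;> rw [eq_stars_of_dirs_eq_nil hc] at hu hv
  · exact ⟨_, Or.inl (aux h1 hu hv)⟩
  · exact ⟨_, Or.inr (aux h1.symm hv hu)⟩

theorem exists_eq_append_stars {d : ℕ} : ∀ {W : List Letter}, d ≤ trail W → ∃ U, W = U ++ stars d
  | [], h => by
    obtain rfl : d = 0 := Nat.le_zero.1 h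
    exact ⟨[], rfl⟩
  | l :: W, h => by
    by_cases hd : d ≤ trail W
    · obtain ⟨U, rfl⟩ := exists_eq_append_stars hd
      exact ⟨l :: U, rfl⟩
    · rw [trail] at h
      split_ifs at h with hl
      · obtain ⟨e, he⟩ : ∃ e, l :: W = stars e := ⟨_, eq_stars_of_dirs_eq_nil hl⟩
        have hle : d ≤ e := by
          have he' : trail (l :: W) = trail (stars e) := by rw [he]
          rw [trail, if_pos hl, ← List.nil_append (stars e), trail_append_stars] at he'
          exact h.trans (he'.trans (Nat.zero_add e)).le
        exact ⟨stars (e - d), by rw [he, List.replicate_append_replicate, Nat.sub_add_cancel hle]⟩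
      · exact absurd h hd

theorem eq_or_exists_of_isRotated_append_singleton {P Q : List Letter} {l : Letter}
    (h : P ++ [l] ~r Q ++ [l]) : P = Q ∨ ∃ u v, P = u ++ [l] ++ v ∧ Q = v ++ [l] ++ u := by
  obtain ⟨u, v, hu, hv⟩ := isRotated_iff_exists_append.1 h
  rcases List.eq_nil_or_concat' u with rfl | ⟨u, c, rfl⟩
  · exact Or.inl (List.append_cancel_right (hu.trans (by simpa using hv.symm)))
  rcases List.eq_nil_or_concat' v with rfl | ⟨v, c', rfl⟩
  · exact Or.inl (List.append_cancel_right ((hu.trans (List.append_nil _)).trans hv.symm))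
  rw [← List.append_assoc] at hu hv
  obtain ⟨hP, hc'⟩ := List.append_inj' hu rfl
  obtain ⟨hQ, hc⟩ := List.append_inj' hv rfl
  rw [← hc] at hP
  rw [← hc'] at hQ
  exact Or.inr ⟨u, v, hP, hQ⟩

theorem eq_barWord_of_isRotated {D : List Letter} {b : Bool}
    (h : D ++ [.ofBool b] ~r barWord D ++ [.ofBool b]) : D = barWord D := by
  rcases eq_or_exists_of_isRotated_append_singleton h with h | ⟨u, v, hD, hbar⟩
  · exact h
  have hD' := congrArg barWord hbar
  rw [barWord_barWord, hD] at hD'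
  simp only [barWord_append, barWord_singleton, Letter.bar_ofBool, List.append_assoc] at hD'
  have hb := (List.append_inj hD' (by simp)).2
  simp at hb

theorem height_area_incompatible {x s i j m : ℤ} (hi : 0 ≤ i) (hj : 0 ≤ j) (hm : m ≤ i + j - 1)
    (hx : |x| ≤ m) (hs : |s| ≤ i) (ht : |-s - 1| ≤ j)
    (h : (x - s) * (i + j + 2) = 1 + j - x) : False := by
  rw [abs_le] at hx hs ht
  rcases lt_trichotomy (x - s) 0 with hlt | heq | hgt
  · nlinarith [hm]
  · rw [heq] at h
    linarith
  · rcases eq_or_lt_of_le (Int.add_one_le_iff.2 hgt) with heq | hgt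
    · rw [← heq] at h
      linarith
    · nlinarith

/-- If the rotation is proper, comparing the areas of both sides gives an equation that the bound of
the heights by the lengths excludes. -/
theorem append_comm_of_isRotated {S T : List Letter} {b : Bool} (hST : height S + height T = 0)
    (h : S ++ stars 2 ++ T ++ [.ofBool b] ~r T ++ stars 2 ++ S ++ [.ofBool b]) :
    S ++ stars 2 ++ T = T ++ stars 2 ++ S := by
  rcases eq_or_exists_of_isRotated_append_singleton h with h | ⟨u, v, hu, hv⟩
  · exact h
  exfalso
  have hareaS := congrArg area hu
  have hareaT := congrArg area hv
  have hheight := congrArg height hu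
  have hlength := congrArg (fun W => (W.length : ℤ)) hu
  have hstars : area (stars 2) = 0 := rfl
  have hsingleton : area [Letter.ofBool b] = (Letter.ofBool b).sgn := by simp [area]
  simp only [area_append, height_append, List.length_append, height_stars, hstars, hsingleton,
    List.length_replicate, List.length_singleton, height_cons, height_nil, Nat.cast_ofNat,
    Nat.cast_add, Nat.cast_one] at hareaS hareaT hheight hlength
  have hu := abs_height_le u
  have hv := abs_height_le v
  have hS := abs_height_le S
  have hi : (0 : ℤ) ≤ u.length := Nat.cast_nonneg _
  have hj : (0 : ℤ) ≤ v.length := Nat.cast_nonneg _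
  rcases Int.isUnit_iff.1 (Letter.isUnit_sgn_ofBool b) with hσ | hσ <;>
    rw [hσ] at hareaS hareaT hheight
  · have hvu : height v = -height u - 1 := by linarith
    rw [hvu] at hv
    exact height_area_incompatible hi hj (by linarith) hS hu hv (by
      linear_combination hareaS - hareaT - height S * hlength +
        (2 + S.length : ℤ) * hST - (1 + u.length : ℤ) * hvu)
  · have hvu : height v = -height u + 1 := by linarith
    rw [hvu, ← abs_neg] at hv
    rw [← abs_neg] at hS hu
    exact height_area_incompatible hi hj (by linarith) hS hu (by convert hv using 2; ring) (by
      linear_combination hareaT - hareaS + height S * hlength -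
        (2 + S.length : ℤ) * hST + (1 + u.length : ℤ) * hvu)

theorem eq_barWord_of_isRotated_contractions {S T : List Letter} {b : Bool}
    (h1 : S ++ [.ofBool b] ++ T ++ stars 2 ~r S ++ stars 2 ++ T ++ [.ofBool b])
    (h2 : S ++ [.ofBool !b] ++ T ++ stars 2 ~r barWord (S ++ stars 2 ++ T ++ [.ofBool b])) :
    T ++ stars 2 ++ S = barWord (T ++ stars 2 ++ S) := by
  refine eq_barWord_of_isRotated (b := !b) ?_
  have hrot := List.isRotated_append (l := T ++ stars 2) (l' := S ++ [.ofBool !b])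
  have hrot' := List.isRotated_append (l := barWord (stars 2) ++ barWord T ++ [.ofBool !b])
    (l' := barWord S)
  have h3 := h2.trans (isRotated_barWord h1).symm
  simp only [barWord_append, barWord_singleton, Letter.bar_ofBool, List.append_assoc] at *
  exact hrot.trans (h3.trans hrot')

theorem exists_powWord_append_stars {u v : List Letter} {d : ℕ} (hd : 0 < d)
    (hdirs : dirs (u ++ v) ≠ [])
    (h : u ++ stars d ++ (v ++ stars d) = v ++ stars d ++ (u ++ stars d)) :
    ∃ U i j, u ++ stars d = powWord (U ++ stars d) (i + 1) ∧
      v ++ stars d = powWord (U ++ stars d) (j + 1) := by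
  obtain ⟨t, i, j, hi, hj⟩ := exists_powWord_of_append_comm _ _ h
  have pos {w : List Letter} {i : ℕ} (hi : w ++ stars d = powWord t i) : ∃ k, i = k + 1 := by
    refine Nat.exists_eq_succ_of_ne_zero ?_
    rintro rfl
    have hw := congrArg List.length hi
    simp only [powWord_zero, List.length_append, List.length_replicate, List.length_nil] at hw
    omega
  obtain ⟨i, rfl⟩ := pos hi
  obtain ⟨j, rfl⟩ := pos hj
  have ht : dirs t ≠ [] := by
    intro ht
    have hu := congrArg dirs hi
    have hv := congrArg dirs hj
    rw [dirs_append, dirs_stars, List.append_nil, dirs_powWord_eq_nil ht] at hu hv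
    exact hdirs (by rw [dirs_append, hu, hv, List.append_nil])
  obtain ⟨U, rfl⟩ := exists_eq_append_stars (d := d) (W := t) (by
    rw [← trail_append_of_ne (V := powWord t i) ht, ← powWord_succ', ← hi, trail_append_stars]
    exact Nat.le_add_left _ _)
  exact ⟨U, i, j, hi, hj⟩

theorem exists_root_of_isRotated {S T : List Letter} {b : Bool} (hd : dirs (S ++ T) ≠ [])
    (h1 : S ++ [.ofBool b] ++ T ++ stars 2 ~r S ++ stars 2 ++ T ++ [.ofBool b])
    (h2 : S ++ [.ofBool !b] ++ T ++ stars 2 ~r barWord (S ++ stars 2 ++ T ++ [.ofBool b])) :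
    ∃ U k, 1 ≤ k ∧ U = barWord U ∧ S ++ stars 2 ++ T = powWord (U ++ stars 2) k ++ U := by
  have hST : height S + height T = 0 := by
    have := height_eq_of_isRotated h2
    simp only [height_barWord, height_append, height_cons, height_nil, height_stars,
      Letter.sgn_ofBool_not] at this
    linarith
  have hcomm : S ++ stars 2 ++ T = T ++ stars 2 ++ S := by
    refine append_comm_of_isRotated (b := b) hST (h1.symm.trans ?_)
    have hrot := List.isRotated_append (l := S ++ [.ofBool b]) (l' := T ++ stars 2)
    simpa only [List.append_assoc] using hrot
  obtain ⟨U, i, j, hi, hj⟩ := exists_powWord_append_stars two_pos hd (by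
    simp only [← List.append_assoc, hcomm])
  have hU : S ++ stars 2 ++ T = powWord (U ++ stars 2) (i + 1 + j) ++ U := by
    refine List.append_cancel_right (bs := stars 2) ?_
    rw [List.append_assoc, List.append_assoc _ U, hi, hj, ← powWord_add, ← powWord_succ']
    rfl
  refine ⟨U, i + 1 + j, by omega, ?_, hU⟩
  have hbar := eq_barWord_of_isRotated_contractions h1 h2
  rw [← hcomm, hU, Nat.add_right_comm, powWord_succ] at hbar
  simp only [barWord_append, List.append_assoc] at hbar
  exact (List.append_inj hbar (by simp)).1

/-! ### Choosing the directions of the symmetric letters -/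

/-- The positions `p` and `q` lie in the same run of symmetric letters. -/
def SameRun (R : List Letter) (p q : ℕ) : Prop :=
  ∀ i, min p q ≤ i → i ≤ max p q → R[i]? = some .star

/-- Orient a letter by choosing the given direction if it is symmetric. -/
def Letter.orient (c : Bool) : Letter → OrientedLetter
  | .plus => .dir true
  | .minus => .dir false
  | .star => .star c

/-- `q` is a factor of the cyclic word `V`, read in one of the two directions, that misses only two
letters. -/
def IsCyclicFactor (q V : List Letter) : Prop :=
  ∃ l₁ l₂, q ++ [l₁, l₂] ~r V ∨ q ++ [l₁, l₂] ~r barWord V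

/-- Every pattern that contains the factors of the cyclic word `R y` that miss two letters also
contains `R`. -/
def IsForcedFactor (R : List Letter) (y : Letter) : Prop :=
  ∀ p, (∀ q, IsCyclicFactor q (R ++ [y]) → Contains q p) → Contains R p

theorem SameRun.symm {R : List Letter} {p q : ℕ} (h : SameRun R p q) : SameRun R q p :=
  fun i h1 h2 => h i (by omega) (by omega)

theorem SameRun.trans {R : List Letter} {p q r : ℕ} (h : SameRun R p q) (h' : SameRun R q r) :
    SameRun R p r := by
  intro i h1 h2
  by_cases hi : min p q ≤ i ∧ i ≤ max p q
  · exact h i hi.1 hi.2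
  · exact h' i (by omega) (by omega)

theorem sameRun_self {R : List Letter} {p : ℕ} (h : R[p]? = some .star) : SameRun R p p := by
  intro i h1 h2
  obtain rfl : i = p := by omega
  exact h

theorem sameRun_succ {R : List Letter} {p : ℕ} (h : R[p]? = some .star)
    (h' : R[p + 1]? = some .star) : SameRun R p (p + 1) := by
  intro i h1 h2
  obtain rfl | rfl : i = p ∨ i = p + 1 := by omega
  · exact h
  · exact h'

section Directions

variable {R : List Letter} {X : Bool → ℕ → Prop}

/-- The parity is fixed by the first marked position of each run. -/
theorem exists_alternating (hX : ∀ z p, X z p → R[p]? = some .star)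
    (hX' : ∀ p, X true p → ¬ X false p)
    (huniq : ∀ z p q, X z p → X z q → SameRun R p q → p = q) :
    ∃ a : ℕ → Bool, (∀ p, R[p]? = some .star → R[p + 1]? = some .star → a (p + 1) = !a p) ∧
      ∀ z p, X z p → a p = z ∨ ∃ q < p, X (!z) q ∧ SameRun R q p := by
  classical
  let marked (p : ℕ) : Set ℕ := {q | (∃ z, X z q) ∧ SameRun R p q}
  let a (p : ℕ) : Bool := decide (X true (sInf (marked p))) ^^ decide (Odd (p + sInf (marked p)))
  refine ⟨a, fun p h0 h1 => ?_, fun z p hz => ?_⟩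
  · have hmarked : marked (p + 1) = marked p := by
      have hrun := sameRun_succ h0 h1
      ext q
      exact and_congr_right fun _ => ⟨hrun.trans, hrun.symm.trans⟩
    simp only [a, hmarked, add_right_comm p 1, Nat.odd_add_one, decide_not, Bool.bne_not]
  · have hp : p ∈ marked p := ⟨⟨z, hz⟩, sameRun_self (hX z p hz)⟩
    obtain ⟨⟨z', hz1⟩, hrun⟩ := Nat.sInf_mem ⟨p, hp⟩
    rcases (Nat.sInf_le hp).lt_or_eq with hlt | heq
    · refine Or.inr ⟨_, hlt, ?_, hrun.symm⟩
      obtain rfl : z' = !z := by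
        by_contra hne
        rw [Bool.eq_not, not_not] at hne
        exact hlt.ne' (huniq z _ _ hz (hne ▸ hz1) hrun)
      exact hz1
    · left
      have hodd : ¬ Odd (p + p) := by simp
      simp only [a, heq, hodd, decide_false, Bool.xor_false]
      cases z
      · exact decide_eq_false fun h => hX' p h hz
      · exact decide_eq_true hz

theorem exists_directions (hX : ∀ z p, X z p → R[p]? = some .star ∧ R[p + 1]? = some .star)
    (hX' : ∀ p, X true p → ¬ X false p)
    (huniq : ∀ z p q, X z p → X z q → SameRun R p q → p = q) :
    ∃ e : ℕ → Bool, (∀ p b, R[p + 1]? = some (.ofBool b) → e p = b) ∧ (∀ z p, X z p → e p = z) ∧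
      ∀ p, R[p]? = some .star → R[p + 1]? = some .star → R[p + 2]? = some .star →
        e p = e (p + 1) → ∃ q < p, X (!(e p)) q ∧ SameRun R q p := by
  classical
  obtain ⟨a, halt, ha⟩ := exists_alternating (fun z p h => (hX z p h).1) hX' huniq
  let e (p : ℕ) : Bool :=
    if h : ∃ z, X z p then h.choose else (R[p + 1]?.bind Letter.dir?).getD (a p)
  have he {z p} (h : X z p) : e p = z := by
    have hex : ∃ z, X z p := ⟨z, h⟩
    simp only [e, dif_pos hex]
    have hspec := hex.choose_spec
    generalize hex.choose = z' at hspec ⊢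
    cases z <;> cases z' <;> first | rfl | exact absurd ‹X false p› (hX' p ‹_›)
  have hea {p} (h0 : R[p + 1]? = some .star) :
      e p = a p ∨ ∃ q < p, X (!(e p)) q ∧ SameRun R q p := by
    by_cases hp : ∃ z, X z p
    · obtain ⟨z, hz⟩ := hp
      rw [he hz]
      exact (ha z p hz).imp_left Eq.symm
    · left
      simp only [e, dif_neg hp, h0]
      rfl
  refine ⟨e, fun p b h => ?_, fun z p => he, fun p h0 h1 h2 hep => ?_⟩
  · have hp : ¬ ∃ z, X z p := fun ⟨z, hz⟩ => by simp [(hX z p hz).2] at h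
    simp only [e, dif_neg hp, h]
    cases b <;> rfl
  · rcases hea h1 with hp | hp
    · rcases hea h2 with hp' | ⟨q, hq, hXq, hrun⟩
      · have halt := halt p h0 h1
        rw [← hp', ← hep, hp] at halt
        exact absurd halt.symm (Bool.not_ne_self _)
      · rw [← hep] at hXq
        have hqp : q ≠ p := by
          rintro rfl
          simpa using he hXq
        exact ⟨q, by omega, hXq, hrun.trans (sameRun_succ h0 h1).symm⟩
    · exact hp

end Directions

theorem letters_mapIdx_orient (e : ℕ → Bool) (R : List Letter) :
    letters (R.mapIdx fun i l => l.orient (e i)) = R := by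
  refine List.ext_getElem (by simp) fun i h1 h2 => ?_
  simp only [letters, List.getElem_map, List.getElem_mapIdx]
  cases R[i] <;> rfl

theorem Letter.orient_eq_star_iff {l : Letter} {c c' : Bool} :
    l.orient c = .star c' ↔ l = .star ∧ c = c' := by
  cases l <;> simp [Letter.orient]

theorem Letter.orient_eq_dir_iff {l : Letter} {c b : Bool} :
    l.orient c = .dir b ↔ l = .ofBool b := by
  cases l <;> cases b <;> simp [Letter.orient, Letter.ofBool]

theorem exists_coherent_of_directions (R : List Letter) (e : ℕ → Bool)
    (he : ∀ p b, R[p + 1]? = some (.ofBool b) → e p = b) :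
    ∃ L, letters L = R ∧ Coherent L ∧
      ∀ L₁ L₂ c, L = L₁ ++ .star c :: L₂ → R[L₁.length]? = some .star ∧ c = e L₁.length := by
  refine ⟨R.mapIdx fun i l => l.orient (e i), letters_mapIdx_orient e R, ?_, fun L₁ L₂ c h => ?_⟩
  · refine List.isChain_iff_getElem.2 fun i hi c b hc hb => ?_
    rw [List.getElem_mapIdx] at hc hb
    rw [← (Letter.orient_eq_star_iff.1 hc).2]
    rw [List.length_mapIdx] at hi
    exact he i b (by rw [List.getElem?_eq_getElem hi, Letter.orient_eq_dir_iff.1 hb])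
  · have hc : (R.mapIdx fun i l => l.orient (e i))[L₁.length]? = some (.star c) := by rw [h]; simp
    rw [List.getElem?_mapIdx, Option.map_eq_some_iff] at hc
    obtain ⟨l, hl, hc⟩ := hc
    obtain ⟨rfl, rfl⟩ := Letter.orient_eq_star_iff.1 hc
    exact ⟨hl, rfl⟩

theorem IsCyclicFactor.length_eq {q V : List Letter} (h : IsCyclicFactor q V) :
    q.length + 2 = V.length := by
  obtain ⟨l₁, l₂, h | h⟩ := h
  · simpa using h.perm.length_eq
  · simpa using h.perm.length_eq

theorem IsCyclicFactor.exists_length_dirs {q V : List Letter} (h : IsCyclicFactor q V) :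
    ∃ l₁ l₂, (q ++ [l₁, l₂] ~r V ∨ q ++ [l₁, l₂] ~r barWord V) ∧
      (dirs q).length + (dirs [l₁, l₂]).length = (dirs V).length := by
  obtain ⟨l₁, l₂, h⟩ := h
  refine ⟨l₁, l₂, h, ?_⟩
  rw [← List.length_append, ← dirs_append]
  rcases h with h | h
  · exact (h.perm.filterMap _).length_eq
  · have hlen : (dirs (q ++ [l₁, l₂])).length = (dirs (barWord V)).length :=
      (h.perm.filterMap _).length_eq
    rw [hlen, dirs_barWord, List.length_reverse, List.length_map]

theorem IsCyclicFactor.length_dirs_le {q V : List Letter} (h : IsCyclicFactor q V) :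
    (dirs q).length ≤ (dirs V).length := by
  obtain ⟨l₁, l₂, -, h⟩ := h.exists_length_dirs
  omega

theorem IsCyclicFactor.isRotated_append_stars {q V : List Letter} (h : IsCyclicFactor q V)
    (hd : (dirs q).length = (dirs V).length) :
    q ++ stars 2 ~r V ∨ q ++ stars 2 ~r barWord V := by
  obtain ⟨l₁, l₂, h, hl⟩ := h.exists_length_dirs
  rwa [eq_stars_of_dirs_eq_nil (W := [l₁, l₂]) (List.length_eq_zero_iff.1 (by omega))] at h

theorem IsForcedFactor.exists_not_fits {L : List OrientedLetter} {y : Letter} (hL : L ≠ [])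
    (h : IsForcedFactor (letters L) y) :
    ∃ q, IsCyclicFactor q (letters L ++ [y]) ∧ ¬ Fits L q := by
  by_contra! hfits
  refine not_contains_avoidingPattern L.length L hL
    (h _ fun q hq => (hfits q hq).contains ?_)
  have := hq.length_eq
  simp only [List.length_append, length_letters, List.length_singleton] at this
  omega

/-! ### Words with a forced factor -/

/-- Contracting the two symmetric letters of `R` at the positions `p` and `p + 1` to one letter of
direction `z` gives a factor of the cyclic word `R b`, read forward if `z = b` and backward
otherwise; these are the only possibilities if `R` has height `0`. -/
def IsContraction (R : List Letter) (b z : Bool) (p : ℕ) : Prop :=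
  ∃ S T, R = S ++ stars 2 ++ T ∧ S.length = p ∧
    S ++ .ofBool z :: (T ++ stars 2) ~r
      if z = b then R ++ [.ofBool b] else barWord (R ++ [.ofBool b])

theorem dirs_eq_nil_of_append_stars_comm {S : List Letter} {d : ℕ} (hd : 0 < d)
    (h : S ++ stars d = stars d ++ S) : dirs S = [] := by
  by_contra hS
  have := congrArg trail h
  rw [trail_append_stars, trail_append_of_ne hS] at this
  omega

theorem SameRun.exists_eq_append_stars {S S' T T' : List Letter}
    (h : S ++ stars 2 ++ T = S' ++ stars 2 ++ T') (hl : S.length ≤ S'.length)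
    (hr : SameRun (S ++ stars 2 ++ T) S.length S'.length) :
    ∃ d, S' = S ++ stars d ∧ T = stars d ++ T' := by
  rw [List.append_assoc, List.append_assoc] at h
  obtain ⟨w, rfl, hT⟩ : ∃ w, S' = S ++ w ∧ stars 2 ++ T = w ++ (stars 2 ++ T') := by
    rcases List.append_eq_append_iff.1 h with h | ⟨w, hw, hT⟩
    · exact h
    · have hwl := congrArg List.length hw
      rw [List.length_append] at hwl
      obtain rfl : w = [] := List.length_eq_zero_iff.1 (by omega)
      exact ⟨[], by simpa using hw.symm, hT.symm⟩
  have hw : w = stars w.length := by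
    refine List.eq_replicate_iff.2 ⟨rfl, fun l hlw => ?_⟩
    obtain ⟨i, hi, rfl⟩ := List.getElem_of_mem hlw
    have hstar := hr (S.length + i) (by simp) (by rw [List.length_append]; omega)
    rw [List.append_assoc, hT, List.getElem?_append_right (by omega),
      List.getElem?_append_left (by omega), List.getElem?_eq_getElem (by omega)] at hstar
    simpa using hstar
  rw [hw] at hT ⊢
  refine ⟨w.length, rfl, ?_⟩
  rw [← List.append_assoc, List.replicate_append_replicate, add_comm,
    ← List.replicate_append_replicate, List.append_assoc] at hT
  exact List.append_cancel_left hT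

section

variable {R : List Letter} {b z : Bool}

theorem isUnit_height_contraction {S T : List Letter} (hR : height (S ++ stars 2 ++ T) = 0) :
    IsUnit (height (S ++ .ofBool z :: T)) := by
  rw [height_append, height_append, height_stars, add_zero] at hR
  rw [height_append, height_cons, add_left_comm, hR, add_zero]
  exact Letter.isUnit_sgn_ofBool z

theorem IsContraction.eq_of_sameRun (hd : dirs R ≠ []) (hR : height R = 0) {p q : ℕ}
    (hp : IsContraction R b z p) (hq : IsContraction R b z q) (hrun : SameRun R p q) : p = q := by
  wlog hpq : p ≤ q
  · exact (this hd hR hq hp hrun.symm (le_of_not_ge hpq)).symm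
  obtain ⟨S, T, rfl, rfl, hS⟩ := hp
  obtain ⟨S', T', hR', rfl, hS'⟩ := hq
  obtain ⟨d, rfl, rfl⟩ := hrun.exists_eq_append_stars hR' hpq
  rw [List.length_append, List.length_replicate]
  obtain ⟨k, ⟨hk, -⟩ | ⟨hk, hk'⟩⟩ := eq_stars_append_of_isRotated (hS.trans hS'.symm)
    (by simp) (by simp) (isUnit_height_contraction hR) <;>
    have hlen := congrArg List.length hk <;>
    simp only [List.length_append, List.length_replicate] at hlen
  · omega
  · obtain rfl : k = d := by omega
    by_contra hne
    have hk0 : 0 < k := by omega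
    apply hd
    have hS0 := dirs_eq_nil_of_append_stars_comm hk0 hk
    have hT0 := dirs_eq_nil_of_append_stars_comm hk0 hk'.symm
    simp only [dirs_append, dirs_stars, hS0, hT0, List.append_nil]

theorem IsContraction.exists_root (hd : dirs R ≠ []) {p : ℕ} (hp : IsContraction R b b p)
    (hp' : IsContraction R b (!b) p) :
    ∃ U k, 1 ≤ k ∧ U = barWord U ∧ R = powWord (U ++ stars 2) k ++ U := by
  obtain ⟨S, T, rfl, rfl, hS⟩ := hp
  obtain ⟨S', T', hR', hlen, hS'⟩ := hp'
  rw [List.append_assoc, List.append_assoc] at hR'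
  obtain ⟨rfl, hT⟩ := List.append_inj hR' hlen.symm
  obtain rfl := List.append_cancel_left hT
  rw [if_pos rfl] at hS
  rw [if_neg (Bool.not_ne_self b)] at hS'
  refine exists_root_of_isRotated (b := b) ?_ ?_ ?_
  · simpa only [dirs_append, dirs_stars, List.append_nil] using hd
  · simpa only [List.append_assoc, List.cons_append, List.nil_append] using hS
  · simpa only [List.append_assoc, List.cons_append, List.nil_append] using hS'

/-- The rotation that relates the two words would have to move symmetric letters from the end to the
beginning. -/
theorem not_isRotated_of_double_loss {S W q₁ q₂ : List Letter} {d : ℕ} (hd : 0 < d)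
    (hne : dirs (S ++ stars 2 ++ (stars d ++ W)) ≠ [])
    (hh : height (S ++ stars 2 ++ (stars d ++ W)) = 0)
    (h1 : StarExpansion (S ++ stars d) q₁) (ht1 : trail q₁ = trail (S ++ stars d))
    (h2 : dirs q₂ = dirs W) (ht2 : dirs W ≠ [] → trail W ≤ trail q₂) :
    ¬ q₁ ++ .ofBool z :: (q₂ ++ stars 2) ~r S ++ .ofBool z :: (stars d ++ W ++ stars 2) := by
  intro hrot
  have hlen := h1.length_le
  have h1' : dirs q₁ = dirs S := by rw [h1.dirs_eq, dirs_append, dirs_stars, List.append_nil]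
  have hunit : IsUnit (height (q₁ ++ .ofBool z :: q₂)) := by
    rw [height_eq_of_dirs_eq (W := S ++ .ofBool z :: (stars d ++ W)) (by simp [h1', h2])]
    exact isUnit_height_contraction hh
  obtain ⟨k, ⟨hk, hk'⟩ | ⟨hk, -⟩⟩ := eq_stars_append_of_isRotated hrot h1'
    (by rw [h2, dirs_append, dirs_stars, List.nil_append]) hunit
  · rw [hk] at hlen
    simp only [List.length_append, List.length_replicate] at hlen
    by_cases hW : dirs W = []
    · have hS : dirs S ≠ [] := by
        simpa only [dirs_append, dirs_stars, hW, List.append_nil] using hne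
      rw [hk, trail_append_stars, trail_append_of_ne hS] at ht1
      omega
    · have htrail := ht2 hW
      rw [← trail_append_of_ne (V := stars d) hW, hk', trail_append_stars] at htrail
      omega
  · have hlen' := congrArg List.length hk
    simp only [List.length_append, List.length_replicate] at hlen hlen'
    omega

theorem height_append_ofBool_cons_of_dirs_eq {L₁ L₂ : List OrientedLetter} {q₁ q₂ : List Letter}
    {c c' : Bool} (h1 : dirs q₁ = dirs (letters L₁)) (h2 : dirs q₂ = dirs (letters L₂)) :
    height (q₁ ++ .ofBool z :: (q₂ ++ stars 2)) =
      height (letters (L₁ ++ .star c :: .star c' :: L₂)) + (Letter.ofBool z).sgn := by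
  simp only [height_append, height_cons, letters_append, letters_star_cons, Letter.sgn_star,
    height_eq_of_dirs_eq h1, height_eq_of_dirs_eq h2, height_stars]
  ring

theorem eq_or_height_eq_zero_of_isRotated {q : List Letter}
    (hq : height q = height R + (Letter.ofBool z).sgn)
    (h : q ~r R ++ [.ofBool b] ∨ q ~r barWord (R ++ [.ofBool b])) : z = b ∨ height R = 0 := by
  rcases h with h | h <;> have hh := height_eq_of_isRotated h <;>
    cases z <;> cases b <;>
    simp [hq, height_barWord, Letter.ofBool, Letter.sgn] at hh ⊢
  · omega
  · omega

theorem isRotated_ite_of_height_eq_zero {q : List Letter} (hR : height R = 0)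
    (hq : height q = height R + (Letter.ofBool z).sgn)
    (h : q ~r R ++ [.ofBool b] ∨ q ~r barWord (R ++ [.ofBool b])) :
    q ~r if z = b then R ++ [.ofBool b] else barWord (R ++ [.ofBool b]) := by
  rcases h with h | h <;> have hh := height_eq_of_isRotated h <;>
    cases z <;> cases b <;>
    simp_all [height_barWord, Letter.ofBool, Letter.sgn]

namespace IsForcedFactor

theorem ne_star (hne : R ≠ []) {y : Letter} (h : IsForcedFactor R y) : y ≠ .star := by
  rintro rfl
  obtain ⟨e, he, -⟩ := exists_directions (R := R) (X := fun _ _ => False) nofun nofun nofun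
  obtain ⟨L, rfl, hcoh, -⟩ := exists_coherent_of_directions R e he
  obtain ⟨q, hq, hf⟩ := h.exists_not_fits (by rintro rfl; exact hne rfl)
  have hd := hq.length_dirs_le
  rw [dirs_append, dirs_star_cons, dirs_nil, List.append_nil] at hd
  have hlen := (starExpansion_of_not_fits hcoh hd hf).length_le
  have := hq.length_eq
  rw [List.length_append, List.length_singleton] at this
  omega

theorem exists_contraction_or_double_loss {L : List OrientedLetter} (hL : L ≠ [])
    (hcoh : Coherent L) (h : IsForcedFactor (letters L) (.ofBool b)) :
    ∃ L₁ L₂ q₁ q₂ z c, L = L₁ ++ .star (!z) :: .star c :: L₂ ∧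
      dirs q₁ = dirs (letters L₁) ∧ dirs q₂ = dirs (letters L₂) ∧
      ((q₁ = letters L₁ ∧ q₂ = letters L₂) ∨
        (c = !z ∧ (∃ c' L₃, L₂ = .star c' :: L₃) ∧
          StarExpansion (letters L₁) q₁ ∧ trail q₁ = trail (letters L₁) ∧
          (dirs (letters L₂) ≠ [] → trail (letters L₂) ≤ trail q₂))) ∧
      (q₁ ++ .ofBool z :: (q₂ ++ stars 2) ~r letters L ++ [.ofBool b] ∨
        q₁ ++ .ofBool z :: (q₂ ++ stars 2) ~r barWord (letters L ++ [.ofBool b])) := by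
  obtain ⟨q, hq, hf⟩ := h.exists_not_fits hL
  have hlen := hq.length_eq
  have hd := hq.length_dirs_le
  simp only [List.length_append, length_letters, List.length_singleton, dirs_append,
    dirs_ofBool_cons, dirs_nil] at hlen hd
  obtain ⟨L₁, L₂, q₁, q₂, z, c, rfl, rfl, h1, h2, hc⟩ :=
    eq_or_double_loss_of_not_fits hcoh (by omega) hd hf
  refine ⟨L₁, L₂, q₁, q₂, z, c, rfl, h1, h2, hc, ?_⟩
  have hrot := hq.isRotated_append_stars (by
    simp only [dirs_append, h1, h2, dirs_ofBool_cons, letters_append, letters_star_cons,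
      dirs_star_cons, List.length_append, List.length_cons, dirs_nil, List.length_nil]
    omega)
  rwa [List.append_assoc, List.cons_append] at hrot

theorem height_eq_zero (hne : R ≠ []) (h : IsForcedFactor R (.ofBool b)) : height R = 0 := by
  let e (p : ℕ) : Bool := (R[p + 1]?.bind Letter.dir?).getD b
  obtain ⟨L, rfl, hcoh, he⟩ := exists_coherent_of_directions R e fun p c hp => by
    simp only [e, hp]
    cases c <;> rfl
  obtain ⟨L₁, L₂, q₁, q₂, z, c, rfl, h1, h2, -, hrot⟩ :=
    h.exists_contraction_or_double_loss (by rintro rfl; exact hne rfl) hcoh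
  refine (eq_or_height_eq_zero_of_isRotated
    (height_append_ofBool_cons_of_dirs_eq h1 h2) hrot).resolve_left fun hz => ?_
  have hstar : (letters (L₁ ++ .star (!z) :: .star c :: L₂))[L₁.length + 1]? = some .star := by
    simp
  have hz' := (he L₁ (.star c :: L₂) (!z) rfl).2
  simp only [e, hstar] at hz'
  exact Bool.not_ne_self z (hz'.trans hz.symm)

/-- Otherwise choose the direction `z` for the first letter of each `**` that contracts to `z`, as
skipping it would need the direction `!z`, and let the directions alternate elsewhere. -/
theorem exists_both_contractions (hd : dirs R ≠ []) (h : IsForcedFactor R (.ofBool b)) :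
    ∃ p, IsContraction R b true p ∧ IsContraction R b false p := by
  have hne : R ≠ [] := by rintro rfl; exact hd rfl
  have hR := h.height_eq_zero hne
  by_contra! hX
  obtain ⟨e, he, hex, hpair⟩ := exists_directions (X := IsContraction R b)
    (by rintro z _ ⟨S, T, rfl, rfl, -⟩; simp [stars, List.replicate_succ]) hX
    (fun z p q hp hq => hp.eq_of_sameRun hd hR hq)
  obtain ⟨L, rfl, hcoh, hL⟩ := exists_coherent_of_directions R e he
  obtain ⟨L₁, L₂, q₁, q₂, z, c, rfl, h1, h2, hc, hrot⟩ :=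
    h.exists_contraction_or_double_loss (by rintro rfl; exact hne rfl) hcoh
  have hRL : letters (L₁ ++ .star (!z) :: .star c :: L₂) =
      letters L₁ ++ stars 2 ++ letters L₂ := by
    simp [stars, List.replicate_succ]
  replace hrot :=
    isRotated_ite_of_height_eq_zero hR (height_append_ofBool_cons_of_dirs_eq h1 h2) hrot
  obtain ⟨hstar₁, hz⟩ := hL L₁ (.star c :: L₂) (!z) rfl
  rcases hc with ⟨rfl, rfl⟩ | ⟨rfl, ⟨c', L₃, rfl⟩, hexp, htrail, htrail'⟩
  · exact Bool.not_ne_self z (hz.trans (hex z _ ⟨_, _, hRL, length_letters L₁, hrot⟩))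
  · obtain ⟨hstar₂, hz'⟩ := hL (L₁ ++ [.star (!z)]) (.star c' :: L₃) (!z) (by simp)
    have hstar₃ := (hL (L₁ ++ [.star (!z), .star (!z)]) L₃ c' (by simp)).1
    simp only [List.length_append, List.length_cons, List.length_nil] at hstar₂ hz' hstar₃
    obtain ⟨p, hp, ⟨S, T, hS, rfl, hrotS⟩, hrun⟩ :=
      hpair _ hstar₁ hstar₂ hstar₃ (hz.symm.trans hz')
    rw [← hz, Bool.not_not] at hrotS
    rw [hS, ← length_letters L₁] at hrun
    rw [← length_letters L₁] at hp
    obtain ⟨d, hd₁, rfl⟩ := hrun.exists_eq_append_stars (hS.symm.trans hRL) hp.le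
    rw [hd₁] at hp hexp htrail
    rw [List.length_append, List.length_replicate] at hp
    rw [hS] at hd hR
    exact not_isRotated_of_double_loss (by omega) hd hR hexp htrail h2 htrail'
      (hrot.trans hrotS.symm)

theorem length_dirs_eq_one_or_exists_root {y : Letter} (hne : R ≠ []) (h : IsForcedFactor R y) :
    (dirs (R ++ [y])).length = 1 ∨
      ∃ b U k, y = .ofBool b ∧ 1 ≤ k ∧ U = barWord U ∧ R = powWord (U ++ stars 2) k ++ U := by
  obtain ⟨b, rfl⟩ := y.eq_star_or_ofBool.resolve_left (h.ne_star hne)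
  by_cases hd : dirs R = []
  · left
    rw [dirs_append, hd, dirs_ofBool_cons]
    rfl
  obtain ⟨p, hp⟩ := h.exists_both_contractions hd
  have hpb : IsContraction R b b p ∧ IsContraction R b (!b) p := by
    cases b
    · exact hp.symm
    · exact hp
  obtain ⟨U, k, hk, hU, hR⟩ := hpb.1.exists_root hd hpb.2
  exact Or.inr ⟨b, U, k, rfl, hk, hU, hR⟩

end IsForcedFactor

end

/-! ### Unrolled cycles -/

theorem Letter.fwd_iff (l : Letter) : l.Fwd ↔ l.allows true := by
  cases l <;> simp [Letter.Fwd, Letter.allows]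

theorem Letter.bwd_iff (l : Letter) : l.Bwd ↔ l.allows false := by
  cases l <;> simp [Letter.Bwd, Letter.allows]

/-- There is an arc from `i` to `j` in the infinite path with the letters `u`, on `ℕ` or `ℤ`. -/
def Near {α : Type*} [Add α] [One α] (u : α → Letter) (i j : α) : Prop :=
  i = j ∨ (j = i + 1 ∧ (u i).allows true) ∨ (i = j + 1 ∧ (u j).allows false)

section Near

variable {α : Type*} [AddMonoidWithOne α] [IsLeftCancelAdd α] [CharZero α] {u : α → Letter} {i : α}

theorem near_succ_iff : Near u i (i + 1) ↔ (u i).allows true := by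
  have htwo : (1 : α) + 1 ≠ 0 := by norm_num
  simp [Near, add_assoc, htwo]

theorem succ_near_iff : Near u (i + 1) i ↔ (u i).allows false := by
  have htwo : (1 : α) + 1 ≠ 0 := by norm_num
  simp [Near, add_assoc, htwo]

end Near

/-- The digraph `G` is a reflexive `n`-cycle, unrolled: `π` runs through its vertices in cyclic
order, and the letter `w i` describes the arcs between `π i` and `π (i + 1)`. -/
structure IsUnrolling {V : Type*} (G : Digraph V) (n : ℕ) (π : ℤ → V) (w : ℤ → Letter) : Prop where
  three_le : 3 ≤ n
  surjective : Function.Surjective π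
  eq_iff : ∀ i j, π i = π j ↔ (n : ℤ) ∣ j - i
  periodic : Function.Periodic w (n : ℤ)
  adj_iff : ∀ i j, G.Adj (π i) (π j) ↔ (n : ℤ) ∣ j - i ∨
    ((n : ℤ) ∣ j - i - 1 ∧ (w i).allows true) ∨
    ((n : ℤ) ∣ i - j - 1 ∧ (w j).allows false)

namespace IsUnrolling

variable {V : Type*} {G : Digraph V} {n : ℕ} {π : ℤ → V} {w : ℤ → Letter}

theorem eq_of_abs_sub_lt (h : IsUnrolling G n π w) {i j : ℤ} (hπ : π i = π j) (hij : |j - i| < n) :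
    i = j := by
  have := Int.eq_zero_of_abs_lt_dvd ((h.eq_iff i j).1 hπ) hij
  lia

theorem exists_lt_eq (h : IsUnrolling G n π w) (c : ℤ) (x : V) :
    ∃ i : ℕ, i < n ∧ π (c + i) = x := by
  obtain ⟨i, rfl⟩ := h.surjective x
  have hn : (0 : ℤ) < n := by have := h.three_le; lia
  obtain ⟨m, hm⟩ := Int.eq_ofNat_of_zero_le (Int.emod_nonneg (i - c) hn.ne')
  have hlt := Int.emod_lt_of_pos (i - c) hn
  refine ⟨m, by lia, ?_⟩
  rw [h.eq_iff, ← hm, ← sub_sub]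
  exact Int.dvd_self_sub_emod

theorem eq_of_dvd (h : IsUnrolling G n π w) {i j : ℤ} (hij : (n : ℤ) ∣ j - i) : w i = w j := by
  obtain ⟨k, hk⟩ := hij
  rw [show j = i + k * n by linarith]
  exact (h.periodic.int_mul k i).symm

theorem shift (h : IsUnrolling G n π w) (c : ℤ) :
    IsUnrolling G n (fun i => π (c + i)) (fun i => w (c + i)) where
  three_le := h.three_le
  surjective x := by
    obtain ⟨i, rfl⟩ := h.surjective x
    exact ⟨i - c, by simp⟩
  eq_iff i j := by rw [h.eq_iff, add_sub_add_left_eq_sub]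
  periodic i := by simp only [← add_assoc, h.periodic (c + i)]
  adj_iff i j := by rw [h.adj_iff, add_sub_add_left_eq_sub, add_sub_add_left_eq_sub]

theorem reflect (h : IsUnrolling G n π w) :
    IsUnrolling G n (fun i => π (-i)) (fun i => (w (-i - 1)).bar) where
  three_le := h.three_le
  surjective x := by
    obtain ⟨i, rfl⟩ := h.surjective x
    exact ⟨-i, by simp⟩
  eq_iff i j := by rw [h.eq_iff, ← dvd_neg]; ring_nf
  periodic i := by
    simp only [← h.periodic (-(i + n) - 1)]
    ring_nf
  adj_iff i j := by
    rw [h.adj_iff, ← dvd_neg]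
    simp only [Letter.allows_bar, Bool.not_true, Bool.not_false]
    have e1 : -(-j - -i) = j - i := by ring
    have e2 : -j - -i - 1 = i - j - 1 := by ring
    have e3 : -i - -j - 1 = j - i - 1 := by ring
    rw [e1, e2, e3, or_comm (a := _ ∧ _)]
    refine or_congr_right (or_congr (and_congr_right fun hd => ?_) (and_congr_right fun hd => ?_))
    · rw [h.eq_of_dvd (i := -j) (j := -i - 1)
        (by rwa [show -i - 1 - -j = j - i - 1 by ring])]
    · rw [h.eq_of_dvd (i := -i) (j := -j - 1)
        (by rwa [show -j - 1 - -i = i - j - 1 by ring])]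

theorem map {V' : Type*} {G' : Digraph V'} (h : IsUnrolling G n π w) (e : G.Adj ≃r G'.Adj) :
    IsUnrolling G' n (fun i => e (π i)) w where
  three_le := h.three_le
  surjective := e.surjective.comp h.surjective
  eq_iff i j := by rw [e.injective.eq_iff, h.eq_iff]
  periodic := h.periodic
  adj_iff i j := by rw [e.map_rel_iff, h.adj_iff]

theorem isomorphic {V' : Type*} {G' : Digraph V'} {π' : ℤ → V'} (h : IsUnrolling G n π w)
    (h' : IsUnrolling G' n π' w) : Isomorphic G G' := by
  have e1 : ∀ x, π (Function.surjInv h.surjective x) = x := Function.surjInv_eq _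
  have e2 : ∀ x, π' (Function.surjInv h'.surjective x) = x := Function.surjInv_eq _
  refine ⟨⟨⟨fun x => π' (Function.surjInv h.surjective x),
    fun x => π (Function.surjInv h'.surjective x), fun x => ?_, fun x => ?_⟩, fun {x y} => ?_⟩⟩
  · conv_rhs => rw [← e1 x]
    rw [h.eq_iff, ← h'.eq_iff, e2]
  · conv_rhs => rw [← e2 x]
    rw [h'.eq_iff, ← h.eq_iff, e1]
  · change G'.Adj (π' _) (π' _) ↔ _
    rw [h'.adj_iff, ← h.adj_iff, e1, e1]

theorem adj_iff_near (h : IsUnrolling G n π w) {i j : ℤ} (hij : |j - i| < n - 1) :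
    G.Adj (π i) (π j) ↔ Near w i j := by
  have hdvd : ∀ {z : ℤ}, |z| < n → ((n : ℤ) ∣ z ↔ z = 0) := fun hz =>
    ⟨fun h => Int.eq_zero_of_abs_lt_dvd h hz, fun h => h ▸ dvd_zero _⟩
  rw [abs_lt] at hij
  rw [h.adj_iff, hdvd (abs_lt.2 ⟨by lia, by lia⟩), hdvd (abs_lt.2 ⟨by lia, by lia⟩),
    hdvd (abs_lt.2 ⟨by lia, by lia⟩), Near]
  refine or_congr (by lia) (or_congr (and_congr_left' ?_) (and_congr_left' ?_)) <;> lia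

theorem adj_of_near (h : IsUnrolling G n π w) {i j : ℤ} (hij : Near w i j) : G.Adj (π i) (π j) := by
  have hn := h.three_le
  refine (h.adj_iff_near (abs_lt.2 ?_)).2 hij
  rcases hij with rfl | ⟨rfl, -⟩ | ⟨rfl, -⟩ <;> constructor <;> lia

theorem adj_succ_iff (h : IsUnrolling G n π w) (i : ℤ) :
    G.Adj (π i) (π (i + 1)) ↔ (w i).allows true := by
  have hn := h.three_le
  rw [h.adj_iff_near (abs_lt.2 ⟨by lia, by lia⟩), near_succ_iff]

theorem succ_adj_iff (h : IsUnrolling G n π w) (i : ℤ) :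
    G.Adj (π (i + 1)) (π i) ↔ (w i).allows false := by
  have hn := h.three_le
  rw [h.adj_iff_near (abs_lt.2 ⟨by lia, by lia⟩), succ_near_iff]

theorem ext_letters (h : IsUnrolling G n π w) {w' : ℤ → Letter} (hw : Function.Periodic w' (n : ℤ))
    (hww : ∀ i : ℕ, i < n → w i = w' i) : w = w' := by
  have hn : 0 < (n : ℤ) := by have := h.three_le; lia
  have hmod : ∀ {v : ℤ → Letter}, Function.Periodic v (n : ℤ) → ∀ i, v (i % n) = v i := by
    intro v hv i
    rw [← hv.int_mul (i / n) (i % n), Int.cast_id, Int.emod_add_ediv_mul]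
  funext i
  obtain ⟨m, hm⟩ := Int.eq_ofNat_of_zero_le (Int.emod_nonneg i hn.ne')
  have hlt := Int.emod_lt_of_pos i hn
  rw [← hmod hw, ← hmod h.periodic, hm, hww m (by lia)]

end IsUnrolling

/-- The vertex of an `n`-cycle with a given position. -/
def windFin {n : ℕ} (hn : 0 < n) (i : ℤ) : Fin n :=
  ⟨(i % n).toNat, by
    have h1 := Int.emod_lt_of_pos i (by omega : (0 : ℤ) < n)
    omega⟩

section windFin

variable {n : ℕ} (hn : 0 < n)

theorem coe_windFin (i : ℤ) : ((windFin hn i).val : ℤ) = i % n :=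
  Int.toNat_of_nonneg (Int.emod_nonneg i (by omega))

theorem windFin_coe (i : Fin n) : windFin hn i.val = i := by
  apply Fin.ext
  zify
  rw [coe_windFin]
  exact Int.emod_eq_of_lt (by omega) (by omega)

theorem windFin_eq_iff (i j : ℤ) : windFin hn i = windFin hn j ↔ (n : ℤ) ∣ j - i := by
  rw [Fin.ext_iff, ← Int.natCast_inj, coe_windFin, coe_windFin]
  exact Int.modEq_iff_dvd

theorem windFin_add (i : ℤ) : windFin hn (i + n) = windFin hn i := by
  rw [windFin_eq_iff]
  simp

theorem cyclicSucc_windFin_iff (i j : ℤ) :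
    CyclicSucc (windFin hn i) (windFin hn j) ↔ (n : ℤ) ∣ j - i - 1 := by
  rw [CyclicSucc, ← Int.natCast_inj]
  push_cast
  rw [coe_windFin, coe_windFin, Int.emod_add_emod, eq_comm, sub_sub]
  exact Int.modEq_iff_dvd

end windFin

open Classical in
/-- The letter that describes the arcs between two adjacent vertices. -/
noncomputable def edgeLetter {V : Type*} (G : Digraph V) (x y : V) : Letter :=
  if G.Adj x y then if G.Adj y x then .star else .plus else .minus

theorem allows_true_edgeLetter {V : Type*} {G : Digraph V} {x y : V} :
    (edgeLetter G x y).allows true ↔ G.Adj x y := by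
  unfold edgeLetter
  split_ifs <;> simp_all [Letter.allows]

theorem allows_false_edgeLetter {V : Type*} {G : Digraph V} {x y : V}
    (h : G.Adj x y ∨ G.Adj y x) : (edgeLetter G x y).allows false ↔ G.Adj y x := by
  unfold edgeLetter
  split_ifs <;> simp_all [Letter.allows]

theorem IsCycle.adj_iff {n : ℕ} {G : Digraph (Fin n)} (hG : IsCycle G) (x y : Fin n) :
    G.Adj x y ↔ x = y ∨ (CyclicSucc x y ∧ G.Adj x y) ∨ (CyclicSucc y x ∧ G.Adj x y) := by
  refine ⟨fun h => ?_, ?_⟩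
  · simpa only [h, and_true] using hG.noOther x y h
  · rintro (rfl | h | h)
    exacts [hG.refl x, h.2, h.2]

theorem IsCycle.exists_isUnrolling {n : ℕ} {G : Digraph (Fin n)} (hn : 3 ≤ n) (hG : IsCycle G) :
    ∃ π w, IsUnrolling G n π w := by
  have hn0 : 0 < n := by lia
  have hsucc : ∀ i j : ℤ, (n : ℤ) ∣ j - i - 1 →
      windFin hn0 (i + 1) = windFin hn0 j := fun i j h => by
    rwa [windFin_eq_iff, ← sub_sub]
  refine ⟨windFin hn0, fun i => edgeLetter G (windFin hn0 i) (windFin hn0 (i + 1)), hn,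
    fun x => ⟨_, windFin_coe hn0 x⟩, windFin_eq_iff hn0, fun i => ?_, fun i j => ?_⟩
  · simp only [windFin_add, add_right_comm i (n : ℤ) 1]
  · rw [hG.adj_iff, windFin_eq_iff, cyclicSucc_windFin_iff, cyclicSucc_windFin_iff]
    refine or_congr_right (or_congr (and_congr_right fun h => ?_) (and_congr_right fun h => ?_))
    · rw [allows_true_edgeLetter, hsucc i j h]
    · rw [hsucc j i h, allows_false_edgeLetter]
      exact hG.consec _ _ ((cyclicSucc_windFin_iff hn0 j i).2 h)

theorem isUnrolling_cycleOfWord {W : List Letter} (hW : 3 ≤ W.length) :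
    ∃ π w, IsUnrolling (cycleOfWord W) W.length π w ∧ ∀ i : Fin W.length, w i.val = W.get i := by
  have hn0 : 0 < W.length := by omega
  refine ⟨windFin hn0, fun i => W.get (windFin hn0 i), ⟨hW, fun x => ⟨_, windFin_coe hn0 x⟩,
    windFin_eq_iff hn0, fun i => ?_, fun i j => ?_⟩, fun i => by simp only [windFin_coe]⟩
  · rw [windFin_add]
  · rw [← windFin_eq_iff hn0, ← cyclicSucc_windFin_iff hn0, ← cyclicSucc_windFin_iff hn0,
      ← Letter.fwd_iff, ← Letter.bwd_iff]
    rfl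

/-! ### Factors of a periodic word -/

/-- The factor of length `k` of the infinite word `w` that starts at `c`. -/
def factor (w : ℤ → Letter) (c : ℤ) (k : ℕ) : List Letter :=
  (List.range k).map fun i : ℕ => w (c + i)

section factor

variable (w : ℤ → Letter) (c : ℤ)

@[simp] theorem length_factor (k : ℕ) : (factor w c k).length = k := by simp [factor]

@[simp] theorem factor_zero : factor w c 0 = [] := rfl

theorem getElem_factor {k i : ℕ} (h : i < (factor w c k).length) :
    (factor w c k)[i] = w (c + i) := by
  simp [factor]

theorem factor_succ (k : ℕ) : factor w c (k + 1) = w c :: factor w (c + 1) k := by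
  simp [factor, List.range_succ_eq_map, add_assoc, add_comm (1 : ℤ), Function.comp_def]

theorem factor_add (k l : ℕ) : factor w c (k + l) = factor w c k ++ factor w (c + k) l := by
  simp [factor, List.range_add, add_assoc, Function.comp_def]

theorem factor_succ' (k : ℕ) : factor w c (k + 1) = factor w c k ++ [w (c + k)] := by
  rw [factor_add, factor_succ, factor_zero]

theorem barWord_factor (k : ℕ) :
    barWord (factor w c k) = factor (fun i => (w (-i - 1)).bar) (-c - k) k := by
  induction k with
  | zero => rfl
  | succ k ih =>
    rw [factor_succ', barWord_append, ih, barWord_singleton, factor_succ, List.singleton_append]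
    push_cast
    congr 3 <;> ring

variable {w c}

theorem eq_factor_of_isRotated {n : ℕ} (hw : Function.Periodic w (n : ℤ)) {W : List Letter}
    (h : W ~r factor w c n) : ∃ c', W = factor w c' n := by
  obtain ⟨m, rfl⟩ := h.symm
  induction m with
  | zero => exact ⟨c, by simp⟩
  | succ m ih =>
    obtain ⟨c', hc'⟩ := ih (List.IsRotated.symm ⟨m, rfl⟩)
    cases n with
    | zero => exact ⟨c, by simp⟩
    | succ n =>
      refine ⟨c' + 1, ?_⟩
      rw [← List.rotate_rotate, hc', factor_succ, List.rotate_cons_succ, List.rotate_zero,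
        factor_succ', ← hw c']
      push_cast
      congr 3
      ring

theorem isRotated_factor {n : ℕ} (hw : Function.Periodic w (n : ℤ)) (c c' : ℤ) :
    factor w c' n ~r factor w c n := by
  have key : ∀ (m : ℕ) (c : ℤ), factor w (c + m) n ~r factor w c n := by
    intro m c
    induction m with
    | zero => rw [Nat.cast_zero, add_zero]
    | succ m ih =>
      refine List.IsRotated.trans ?_ ih
      cases n with
      | zero => simp
      | succ n =>
        rw [factor_succ w (c + m), factor_succ']
        have : w (c + (m + 1 : ℕ) + n) = w (c + m) := by
          rw [← hw (c + m)]
          push_cast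
          ring_nf
        rw [this, Nat.cast_succ, ← add_assoc]
        exact (List.isRotated_append (l := [_])).symm
  rcases le_total c c' with h | h
  · obtain ⟨m, hm⟩ := Int.eq_ofNat_of_zero_le (sub_nonneg.2 h)
    rw [show c' = c + m by linarith]
    exact key m c
  · obtain ⟨m, hm⟩ := Int.eq_ofNat_of_zero_le (sub_nonneg.2 h)
    rw [show c = c' + m by linarith]
    exact (key m c').symm

end factor

theorem isCyclicFactor_factor {w : ℤ → Letter} {m : ℕ}
    (hw : Function.Periodic w ((m + 2 : ℕ) : ℤ)) (c c' : ℤ) :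
    IsCyclicFactor (factor w c m) (factor w c' (m + 2)) := by
  refine ⟨w (c + m), w (c + m + 1), Or.inl ?_⟩
  rw [← factor_zero w (c + m + 1 + 1), ← factor_succ, ← factor_succ, ← factor_add]
  exact isRotated_factor hw _ _

namespace IsUnrolling

variable {V : Type*} {G : Digraph V} {n : ℕ} {π : ℤ → V} {w : ℤ → Letter}

theorem exists_isUnrolling_of_isRotated (h : IsUnrolling G n π w) {W : List Letter} {c : ℤ}
    (hW : W ~r factor w c n) : ∃ π' w', IsUnrolling G n π' w' ∧ W = factor w' 0 n := by
  obtain ⟨c', rfl⟩ := eq_factor_of_isRotated h.periodic hW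
  exact ⟨_, _, h.shift c', by simp only [factor, zero_add]⟩

theorem exists_isUnrolling_of_isRotated_barWord (h : IsUnrolling G n π w) {W : List Letter} {c : ℤ}
    (hW : W ~r barWord (factor w c n)) : ∃ π' w', IsUnrolling G n π' w' ∧ W = factor w' 0 n := by
  rw [barWord_factor] at hW
  exact h.reflect.exists_isUnrolling_of_isRotated hW

theorem exists_isUnrolling_of_isCyclicFactor (h : IsUnrolling G n π w) {q : List Letter} {c : ℤ}
    (hq : IsCyclicFactor q (factor w c n)) :
    ∃ π' w', IsUnrolling G n π' w' ∧ q = factor w' 0 q.length := by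
  have hn : n = q.length + 2 := by rw [hq.length_eq, length_factor]
  obtain ⟨l₁, l₂, hq⟩ := hq
  obtain ⟨π', w', h', hw'⟩ := hq.elim h.exists_isUnrolling_of_isRotated
    h.exists_isUnrolling_of_isRotated_barWord
  rw [hn, factor_add] at hw'
  exact ⟨π', w', h', (List.append_inj hw' (by simp)).1⟩

end IsUnrolling

/-! ### Paths with given letters -/

/-- The path of length `k` with the letters `u`. -/
def pathOfFn (u : ℕ → Letter) (k : ℕ) : Digraph (Fin (k + 1)) where
  Adj i j := Near u i j

theorem isPath_pathOfFn (u : ℕ → Letter) (k : ℕ) : IsPath (pathOfFn u k) where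
  refl i := Or.inl rfl
  consec i := by
    change Near u i (i + 1) ∨ Near u (i + 1) i
    rw [near_succ_iff, succ_near_iff]
    cases u i <;> simp [Letter.allows]
  noOther i j h := by
    rcases h with h | h | h
    · exact Or.inl (Fin.ext h)
    · exact Or.inr (Or.inl h.1.symm)
    · exact Or.inr (Or.inr h.1.symm)

theorem pathWord_pathOfFn (u : ℕ → Letter) (k : ℕ) :
    pathWord (pathOfFn u k) = (List.range k).map u := by
  refine List.ext_getElem (by simp [pathWord]) fun i h1 h2 => ?_
  simp only [pathWord, pathOfFn, List.getElem_ofFn, Fin.val_castSucc, Fin.val_succ, near_succ_iff,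
    succ_near_iff, List.getElem_map, List.getElem_range]
  cases u i <;> simp [Letter.allows]

theorem pathOfFn_congr {u v : ℕ → Letter} {k : ℕ}
    (huv : (List.range k).map u = (List.range k).map v) : pathOfFn u k = pathOfFn v k := by
  simp only [List.map_inj_left, List.mem_range] at huv
  ext i j
  refine or_congr_right (or_congr (and_congr_right fun h => ?_) (and_congr_right fun h => ?_)) <;>
    rw [huv _ (by lia)]

theorem near_natCast_iff {w : ℤ → Letter} {i j : ℕ} :
    Near (fun i : ℕ => w i) i j ↔ Near w i j := by
  simp only [Near]
  norm_cast

theorem IsUnrolling.embeds_pathOfFn {V : Type*} {G : Digraph V} {n : ℕ} {π : ℤ → V} {w : ℤ → Letter}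
    (h : IsUnrolling G n π w) {k : ℕ} (hk : k + 2 ≤ n) :
    Embeds (pathOfFn (fun i : ℕ => w i) k) G := by
  have hle : ∀ i : Fin (k + 1), i.val ≤ k := fun i => i.is_le
  refine ⟨⟨⟨fun i => π i.val, fun i j hij => Fin.ext ?_⟩, fun {i j} => ?_⟩⟩
  · exact_mod_cast h.eq_of_abs_sub_lt hij (abs_lt.2 ⟨by grind, by grind⟩)
  · exact (h.adj_iff_near (abs_lt.2 ⟨by grind, by grind⟩)).trans near_natCast_iff.symm

theorem IsUnrolling.embeds_of_isCyclicFactor {V : Type*} {G : Digraph V} {n : ℕ} {π : ℤ → V}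
    {w : ℤ → Letter} (h : IsUnrolling G n π w) {u : ℕ → Letter} {k : ℕ} {c : ℤ}
    (hu : IsCyclicFactor ((List.range k).map u) (factor w c n)) : Embeds (pathOfFn u k) G := by
  obtain ⟨π', w', h', hw'⟩ := h.exists_isUnrolling_of_isCyclicFactor hu
  have hk := hu.length_eq
  simp only [List.length_map, List.length_range, length_factor] at hw' hk
  rw [pathOfFn_congr (v := fun i : ℕ => w' i) (hw'.trans (by simp only [factor, zero_add]))]
  exact h'.embeds_pathOfFn (by lia)

/-! ### Folding two contracted paths onto a cycle -/

/-- The word `w` with the letters number `a` and `a + 1` replaced by the letter `l`. -/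
def contractAt (w : ℕ → Letter) (a : ℕ) (l : Letter) (i : ℕ) : Letter :=
  if i < a then w i else if i = a then l else w (i + 1)

theorem map_contractAt (w : ℕ → Letter) (a t : ℕ) (l : Letter) :
    (List.range (a + 1 + t)).map (contractAt w a l) =
      (List.range a).map w ++ l :: (List.range t).map fun i => w (a + 2 + i) := by
  have hlt : ∀ i ∈ List.range a, contractAt w a l i = w i := fun i hi =>
    if_pos (List.mem_range.1 hi)
  have hgt : ∀ i, contractAt w a l (a + 1 + i) = w (a + 2 + i) := fun i => by
    rw [contractAt, if_neg (by lia), if_neg (by lia), add_right_comm]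
  have ha : contractAt w a l a = l := by simp [contractAt]
  rw [List.range_add, List.range_succ, List.map_append, List.map_append,
    List.map_congr_left hlt, List.map_map]
  simp [Function.comp_def, ha, hgt]

/-- A homomorphism from the product of the two paths with letters `contractAt w a .plus` and
`contractAt w a .minus` onto the path with letters `w`, if these are symmetric at `a`, `a + 1`. -/
def fold (a x y : ℕ) : ℕ :=
  if x ≤ a ∧ y ≤ a then max x y else if a < x ∧ a < y then min x y + 1 else a + 1

theorem near_fold {w : ℕ → Letter} {a : ℕ} (h1 : w a = .star) (h2 : w (a + 1) = .star)
    {x x' y y' : ℕ} (hx : Near (contractAt w a .plus) x x')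
    (hy : Near (contractAt w a .minus) y y') : Near w (fold a x y) (fold a x' y') := by
  have hstar : ∀ c, (w a).allows c ∧ (w (a + 1)).allows c := fun c => by simp [h1, h2]
  have hplus : Letter.plus.allows false = false := rfl
  have hminus : Letter.minus.allows true = false := rfl
  rcases hx with rfl | ⟨rfl, hx⟩ | ⟨rfl, hx⟩ <;> rcases hy with rfl | ⟨rfl, hy⟩ | ⟨rfl, hy⟩
  all_goals grind [Near, fold, contractAt]

theorem exists_fold_eq {a k i : ℕ} (hi : i ≤ k + 1) (ha : a + 1 ≤ k) :
    ∃ x y, x ≤ k ∧ y ≤ k ∧ fold a x y = i := by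
  rcases lt_trichotomy i (a + 1) with h | h | h
  · exact ⟨i, i, by lia, by lia, by unfold fold; split_ifs <;> lia⟩
  · exact ⟨a + 1, a, by lia, by lia, by unfold fold; split_ifs <;> lia⟩
  · exact ⟨i - 1, i - 1, by lia, by lia, by unfold fold; split_ifs <;> lia⟩

namespace IsUnrolling

variable {n : ℕ} {G : Digraph (Fin n)} {π : ℤ → Fin n} {w : ℤ → Letter}

theorem not_pathCondition_of_embeds (h : IsUnrolling G n π w) {a : ℕ} (ha : a + 3 ≤ n)
    (h1 : w a = .star) (h2 : w (a + 1) = .star)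
    (hG : ∀ b, Embeds (pathOfFn (contractAt (fun i : ℕ => w i) a (.ofBool b)) (n - 2)) G) :
    ¬ PathCondition G := by
  refine not_not.2 ⟨2, fun i => pathOfFn (contractAt (fun i : ℕ => w i) a
    (if i = 0 then .plus else .minus)) (n - 2), by norm_num,
    fun i => ⟨isPath_pathOfFn _ _, ?_⟩,
    ⟨fun x => π (fold a (x 0).val (x 1).val : ℕ), fun {x x'} hx => ?_⟩, fun z => ?_⟩
  · fin_cases i
    · exact hG true
    · exact hG false
  · exact h.adj_of_near (near_natCast_iff.1 (near_fold h1 h2 (hx 0) (hx 1)))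
  · obtain ⟨i, hi, rfl⟩ := h.exists_lt_eq 0 z
    obtain ⟨x, y, hx, hy, hxy⟩ := exists_fold_eq (a := a) (i := i) (k := n - 2) (by lia) (by lia)
    exact ⟨![⟨x, by lia⟩, ⟨y, by lia⟩], by simp [hxy]⟩

theorem not_pathCondition (h : IsUnrolling G n π w) {S T : List Letter} {y : Letter} {c : ℤ}
    (hV : factor w c n = S ++ stars 2 ++ T ++ [y])
    (hST : ∀ b, IsCyclicFactor (S ++ .ofBool b :: T) (factor w c n)) : ¬ PathCondition G := by
  have hlen := congrArg List.length hV
  simp only [length_factor, List.length_append, List.length_replicate,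
    List.length_singleton] at hlen
  have hw := hV
  rw [hlen, factor_add, factor_add, factor_add] at hw
  obtain ⟨hw, -⟩ := List.append_inj' hw (by simp)
  obtain ⟨hw, hT⟩ := List.append_inj' hw (by simp)
  obtain ⟨hS, hst⟩ := List.append_inj' hw (by simp)
  simp only [factor_succ, factor_zero, stars, List.replicate_succ, List.replicate_zero,
    List.cons.injEq, and_true] at hst
  refine (h.shift c).not_pathCondition_of_embeds (a := S.length) (by lia) hst.1
    (by rw [← add_assoc]; exact hst.2) fun b => h.embeds_of_isCyclicFactor (c := c) ?_
  rw [show n - 2 = S.length + 1 + T.length by lia, map_contractAt]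
  convert hST b
  · exact hS
  · rw [← hT]
    simp [factor, add_assoc]

end IsUnrolling

/-! ### Cycles that fail the path condition -/

namespace IsUnrolling

variable {V : Type*} {G : Digraph V} {n : ℕ} {π : ℤ → V} {w : ℤ → Letter}

/-- The only arc between `π i` and `π (i + 1)`, if the letter `w i` is not symmetric. -/
def arc (π : ℤ → V) (w : ℤ → Letter) (i : ℤ) : V × V :=
  if (w i).allows true then (π i, π (i + 1)) else (π (i + 1), π i)

theorem arc_spec (h : IsUnrolling G n π w) {i : ℤ} (hi : w i ≠ .star) :
    G.Adj (arc π w i).1 (arc π w i).2 ∧ ¬ G.Adj (arc π w i).2 (arc π w i).1 := by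
  obtain ⟨b, hb⟩ := (w i).eq_star_or_ofBool.resolve_left hi
  cases b <;> simp [arc, h.adj_succ_iff, h.succ_adj_iff, hb]

theorem exists_arc_eq (h : IsUnrolling G n π w) {x y : V} (hxy : G.Adj x y) (hyx : ¬ G.Adj y x) :
    ∃ i, w i ≠ .star ∧ (x, y) = arc π w i := by
  have hsucc : ∀ {i j : ℤ}, (n : ℤ) ∣ j - i - 1 → π j = π (i + 1) := fun hij => by
    rwa [eq_comm, h.eq_iff, ← sub_sub]
  obtain ⟨i, rfl⟩ := h.surjective x
  obtain ⟨j, rfl⟩ := h.surjective y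
  rcases (h.adj_iff i j).1 hxy with h1 | ⟨h1, h2⟩ | ⟨h1, -⟩
  · rw [(h.eq_iff i j).2 h1] at hxy hyx
    exact absurd hxy hyx
  · rw [hsucc h1, h.succ_adj_iff] at hyx
    exact ⟨i, fun hi => hyx (by rw [hi, Letter.allows_star]), by rw [arc, if_pos h2, hsucc h1]⟩
  · rw [hsucc h1, h.adj_succ_iff] at hyx
    exact ⟨j, fun hj => hyx (by rw [hj, Letter.allows_star]), by rw [arc, if_neg hyx, hsucc h1]⟩

theorem eq_of_arc_eq (h : IsUnrolling G n π w) {i j : ℤ} (hij : arc π w i = arc π w j) :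
    π i = π j := by
  have hn := h.three_le
  have hopp : ∀ {i j}, π i = π (j + 1) → π (i + 1) = π j → False := fun {i j} h1 h2 => by
    rw [h.eq_iff] at h1 h2
    have := Int.le_of_dvd (by lia) (dvd_sub h1 h2)
    lia
  unfold arc at hij
  split_ifs at hij <;> rw [Prod.mk.injEq] at hij
  · exact hij.1
  · exact (hopp hij.1 hij.2).elim
  · exact (hopp hij.2 hij.1).elim
  · exact hij.2

end IsUnrolling

theorem exists_factor_eq_iff {w : ℤ → Letter} {m : ℕ}
    (hw : Function.Periodic w ((m + 1 : ℕ) : ℤ)) :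
    (∃ c b, factor w c (m + 1) = stars m ++ [.ofBool b]) ↔
      ∃ c, ∀ i, w i ≠ .star ↔ ((m + 1 : ℕ) : ℤ) ∣ c - i := by
  constructor
  · rintro ⟨c, b, h⟩
    rw [factor_succ'] at h
    obtain ⟨hs, hb⟩ := List.append_inj h (by simp)
    have hstar : ∀ r < m, w (c + r) = .star := fun r hr =>
      (List.eq_replicate_iff.1 hs).2 _ (List.mem_map_of_mem (List.mem_range.2 hr))
    rw [List.singleton_inj] at hb
    refine ⟨c + m, fun i => ?_⟩
    have hpos : 0 < ((m + 1 : ℕ) : ℤ) := by lia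
    obtain ⟨r, hr⟩ := Int.eq_ofNat_of_zero_le (Int.emod_nonneg (i - c) hpos.ne')
    have hlt := Int.emod_lt_of_pos (i - c) hpos
    obtain ⟨k, rfl⟩ : ∃ k, i = c + r + k * (m + 1 : ℕ) :=
      ⟨(i - c) / (m + 1 : ℕ), by rw [← hr, add_assoc, Int.emod_add_ediv_mul, add_sub_cancel]⟩
    have hwr : w (c + r + k * (m + 1 : ℕ)) = w (c + r) := hw.int_mul k _
    rw [hwr,
      show c + m - (c + r + k * (m + 1 : ℕ)) = (m - r : ℤ) - k * (m + 1 : ℕ) by ring,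
      dvd_sub_left (dvd_mul_left _ _)]
    rcases (by lia : r < m ∨ r = m) with hrm | rfl
    · simpa [hstar r hrm] using mt (Int.le_of_dvd (by lia)) (by lia : ¬ ((m + 1 : ℕ) : ℤ) ≤ m - r)
    · simp [hb]
  · rintro ⟨c, hc⟩
    obtain ⟨b, hb⟩ := (w c).eq_star_or_ofBool.resolve_left ((hc c).2 (by simp))
    refine ⟨c + 1, b, ?_⟩
    rw [factor_succ', ← hb, ← hw c]
    congr 1
    · refine List.eq_replicate_iff.2 ⟨length_factor .., fun l hl => ?_⟩
      simp only [factor, List.mem_map, List.mem_range] at hl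
      obtain ⟨i, hi, rfl⟩ := hl
      by_contra hne
      have := Int.le_of_dvd (by lia) ((dvd_neg).2 ((hc _).1 hne))
      lia
    · push_cast
      ring_nf

theorem IsUnrolling.almostSymmetric_iff {n : ℕ} {G : Digraph (Fin n)} {π : ℤ → Fin n}
    {w : ℤ → Letter} (h : IsUnrolling G n π w) :
    AlmostSymmetric G ↔ ∃ c b, factor w c n = stars (n - 1) ++ [.ofBool b] := by
  obtain ⟨m, rfl⟩ : ∃ m, n = m + 1 := ⟨n - 1, by have := h.three_le; lia⟩
  rw [Nat.add_sub_cancel, exists_factor_eq_iff h.periodic]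
  constructor
  · rintro ⟨⟨x, y⟩, ⟨h1, h2⟩, huniq⟩
    obtain ⟨c, hc, hxy⟩ := h.exists_arc_eq h1 h2
    refine ⟨c, fun i => ⟨fun hi => ?_, fun hi => by rwa [h.eq_of_dvd hi]⟩⟩
    rw [← h.eq_iff]
    exact h.eq_of_arc_eq ((huniq _ (h.arc_spec hi)).trans hxy)
  · rintro ⟨c, hc⟩
    refine ⟨arc π w c, h.arc_spec ((hc c).2 (by simp)), ?_⟩
    rintro ⟨x, y⟩ ⟨h1, h2⟩
    obtain ⟨i, hi, hxy⟩ := h.exists_arc_eq h1 h2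
    have hd := (hc i).1 hi
    rw [hxy, arc, arc, h.eq_of_dvd hd, (h.eq_iff i c).2 hd,
      (h.eq_iff (i + 1) (c + 1)).2 (by simpa using hd)]

theorem barWord_stars (m : ℕ) : barWord (stars m) = stars m := by simp [barWord]

theorem IsUnrolling.not_pathCondition_of_almostSymmetric {n : ℕ} {G : Digraph (Fin n)}
    {π : ℤ → Fin n} {w : ℤ → Letter} (h : IsUnrolling G n π w) (hG : AlmostSymmetric G) :
    ¬ PathCondition G := by
  obtain ⟨c, b, hb⟩ := h.almostSymmetric_iff.1 hG
  obtain ⟨m, rfl⟩ : ∃ m, n = m + 3 := ⟨n - 3, by have := h.three_le; lia⟩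
  have hst : stars (m + 2) = stars m ++ stars 2 := List.replicate_add ..
  rw [show m + 3 - 1 = m + 2 by lia] at hb
  refine h.not_pathCondition (S := []) (T := stars m) (y := .ofBool b) (c := c) ?_ fun b' => ?_
  · rw [hb, add_comm m, List.nil_append, stars, List.replicate_add]
  · refine ⟨.star, .star, ?_⟩
    change .ofBool b' :: (stars m ++ stars 2) ~r _ ∨ .ofBool b' :: (stars m ++ stars 2) ~r _
    rw [hb, ← hst, barWord_append, barWord_stars, barWord_singleton, Letter.bar_ofBool]
    rcases Bool.eq_or_eq_not b' b with rfl | rfl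
    · exact Or.inl (List.isRotated_append (l := [_]))
    · exact Or.inr (List.IsRotated.refl _)

theorem powWord_append_stars_succ_append (U : List Letter) (k : ℕ) :
    powWord (U ++ stars 2) (k + 1) ++ U = powWord (U ++ stars 2) k ++ U ++ stars 2 ++ U := by
  simp only [powWord_succ', List.append_assoc]

theorem barWord_powWord_append {U : List Letter} (hU : U = barWord U) (k : ℕ) :
    barWord (powWord (U ++ stars 2) k ++ U) = powWord (U ++ stars 2) k ++ U := by
  induction k with
  | zero => exact hU.symm
  | succ k ih =>
    rw [powWord_succ, List.append_assoc, barWord_append, ih, barWord_append, ← hU, barWord_stars,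
      ← List.append_assoc (bs := stars 2), ← powWord_append_stars_succ_append, powWord_succ,
      List.append_assoc]

theorem isCyclicFactor_contraction {U : List Letter} (hU : U = barWord U) (k : ℕ) (b : Bool) :
    IsCyclicFactor (U ++ .ofBool b :: (powWord (U ++ stars 2) k ++ U))
      (powWord (U ++ stars 2) (k + 1) ++ U ++ [.ofBool true]) := by
  refine ⟨.star, .star, ?_⟩
  rw [show [Letter.star, .star] = stars 2 from rfl]
  cases b
  · right
    rw [barWord_append, barWord_powWord_append hU, powWord_append_stars_succ_append,
      barWord_singleton, Letter.bar_ofBool, Bool.not_true]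
    have hrot := List.isRotated_append (l := U)
      (l' := .ofBool false :: (powWord (U ++ stars 2) k ++ U ++ stars 2))
    simpa only [List.append_assoc, List.cons_append, List.nil_append] using hrot
  · left
    rw [powWord_append_stars_succ_append]
    have hrot := List.isRotated_append (l := U ++ [.ofBool true])
      (l' := powWord (U ++ stars 2) k ++ U ++ stars 2)
    simpa only [List.append_assoc, List.cons_append, List.nil_append] using hrot

theorem eq_factor_of_get {w : ℤ → Letter} {W : List Letter}
    (hw : ∀ i : Fin W.length, w i.val = W.get i) : W = factor w 0 W.length := by
  refine List.ext_getElem (by simp) fun i h1 h2 => ?_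
  rw [getElem_factor, zero_add]
  exact (hw ⟨i, h1⟩).symm

theorem HasSpecialForm.not_pathCondition {n : ℕ} {G : Digraph (Fin n)} (hn : 3 ≤ n)
    (hG : IsCycle G) (h : HasSpecialForm G) : ¬ PathCondition G := by
  rcases h with h | ⟨s, S, k, -, hS, hk, ⟨e⟩⟩
  · obtain ⟨π, w, hw⟩ := hG.exists_isUnrolling hn
    exact hw.not_pathCondition_of_almostSymmetric h
  · obtain rfl : n = (starWord S k).length := by simpa using Fintype.card_congr e.toEquiv
    obtain ⟨π, w, hw, hwV⟩ := isUnrolling_cycleOfWord hn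
    obtain ⟨k, rfl⟩ := Nat.exists_eq_add_of_le' hk
    have hV := eq_factor_of_get hwV
    refine (hw.map e.symm).not_pathCondition (S := pathWord S)
      (T := powWord (pathWord S ++ stars 2) k ++ pathWord S) (y := .ofBool true) (c := 0) ?_
      fun b => ?_
    · rw [← hV, starWord, powWord_succ]
      simp only [List.append_assoc]
      rfl
    · rw [← hV]
      exact isCyclicFactor_contraction hS k b

/-! ### Paths that embed in a cycle -/

/-- There is an arc between the two vertices, in one of the two directions. -/
def Linked {V : Type*} (G : Digraph V) (x y : V) : Prop := G.Adj x y ∨ G.Adj y x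

theorem IsCyclicFactor.barWord {q V : List Letter} (h : IsCyclicFactor q V) :
    IsCyclicFactor (barWord q) V := by
  have hbar : ∀ {W W' : List Letter}, W ~r W' → CycleWords.barWord W ~r CycleWords.barWord W' :=
    fun h => (h.map _).reverse
  obtain ⟨l₁, l₂, h⟩ := h
  have hrot : CycleWords.barWord q ++ [l₂.bar, l₁.bar] ~r CycleWords.barWord (q ++ [l₁, l₂]) := by
    rw [barWord_append]
    exact List.isRotated_append
  refine ⟨l₂.bar, l₁.bar, h.symm.imp (fun h => ?_) fun h => hrot.trans (hbar h)⟩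
  simpa only [barWord_barWord] using hrot.trans (hbar h)

namespace IsUnrolling

variable {V : Type*} {G : Digraph V} {n : ℕ} {π : ℤ → V} {w : ℤ → Letter}

theorem exists_of_linked (h : IsUnrolling G n π w) {i : ℤ} {y : V} (hy : Linked G (π i) y) :
    ∃ j, |j - i| ≤ 1 ∧ π j = y := by
  obtain ⟨j, rfl⟩ := h.surjective y
  simp only [Linked, h.adj_iff] at hy
  have hself : ∀ t : ℤ, (n : ℤ) ∣ j - i - t → π (i + t) = π j := fun t ht => by
    rwa [h.eq_iff, ← sub_sub]
  rcases hy with (hd | ⟨hd, -⟩ | ⟨hd, -⟩) | hd | ⟨hd, -⟩ | ⟨hd, -⟩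
  · exact ⟨i + 0, by simp, hself 0 (by simpa using hd)⟩
  · exact ⟨i + 1, by simp, hself 1 hd⟩
  · exact ⟨i + -1, by simp, hself (-1) (by rw [← dvd_neg]; ring_nf at hd ⊢; exact hd)⟩
  · exact ⟨i + 0, by simp, hself 0 (by rw [← dvd_neg]; simpa using hd)⟩
  · exact ⟨i + -1, by simp, hself (-1) (by rw [← dvd_neg]; ring_nf at hd ⊢; exact hd)⟩
  · exact ⟨i + 1, by simp, hself 1 hd⟩

theorem eq_of_injective (h : IsUnrolling G n π w) {k : ℕ} {p : ℕ → V}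
    (hadj : ∀ j < k, Linked G (p j) (p (j + 1)))
    (hinj : ∀ i j, i ≤ k → j ≤ k → p i = p j → i = j) {c : ℤ} (h0 : p 0 = π c)
    (h1 : 1 ≤ k → p 1 = π (c + 1)) : ∀ j ≤ k, p j = π (c + j) := by
  intro j
  induction j using Nat.twoStepInduction with
  | zero => simpa using h0
  | one => simpa using h1
  | more j ih₀ ih₁ =>
    intro hj
    have hlink := hadj (j + 1) (by lia)
    rw [ih₁ (by lia)] at hlink
    obtain ⟨i, hi, hij⟩ := h.exists_of_linked hlink
    rw [abs_le] at hi
    rcases (by lia : i = c + (j + 1 : ℕ) ∨ i = c + j ∨ i = c + (j + 2 : ℕ)) with rfl | rfl | rfl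
    · have := hinj (j + 1) (j + 2) (by lia) hj ((ih₁ (by lia)).trans hij)
      lia
    · have := hinj j (j + 2) (by lia) hj ((ih₀ (by lia)).trans hij)
      lia
    · exact hij.symm

theorem exists_shift_of_injective (h : IsUnrolling G n π w) {k : ℕ} {p : ℕ → V}
    (hadj : ∀ j < k, Linked G (p j) (p (j + 1)))
    (hinj : ∀ i j, i ≤ k → j ≤ k → p i = p j → i = j) :
    ∃ c, (∀ j ≤ k, p j = π (c + j)) ∨ ∀ j ≤ k, p j = π (-(c + j)) := by
  obtain ⟨c, hc⟩ := h.surjective (p 0)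
  rcases Nat.eq_zero_or_pos k with rfl | hk
  · exact ⟨c, Or.inl (h.eq_of_injective hadj hinj hc.symm nofun)⟩
  obtain ⟨i, hi, hp⟩ := h.exists_of_linked (hc ▸ hadj 0 hk)
  rw [abs_le] at hi
  rcases (by lia : i = c ∨ i = c + 1 ∨ i = c - 1) with rfl | rfl | rfl
  · have := hinj _ _ hk (Nat.zero_le _) (hp.symm.trans hc)
    lia
  · exact ⟨c, Or.inl (h.eq_of_injective hadj hinj hc.symm fun _ => hp.symm)⟩
  · refine ⟨-c, Or.inr (h.reflect.eq_of_injective hadj hinj (by simpa using hc.symm) fun _ => ?_)⟩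
    rw [← hp]
    ring_nf

theorem exists_letters_of_embeds (h : IsUnrolling G n π w) {k : ℕ} (hk : k + 2 = n)
    {Q : Digraph (Fin (k + 1))} (hQ : IsPath Q) (hE : Embeds Q G) :
    ∃ u, Q = pathOfFn u k ∧ ∀ c, IsCyclicFactor ((List.range k).map u) (factor w c n) := by
  subst hk
  obtain ⟨φ⟩ := hE
  have hφ : ∀ i (hi : i ≤ k), Fin.ofNat (k + 1) i = ⟨i, by lia⟩ := fun i hi =>
    Fin.ext (Nat.mod_eq_of_lt (by lia))
  have hQw : ∀ {π w}, IsUnrolling G (k + 2) π w →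
      (∀ j ≤ k, φ (Fin.ofNat (k + 1) j) = π (j : ℕ)) → Q = pathOfFn (fun i : ℕ => w i) k := by
    intro π w h hπ
    have hle : ∀ i : Fin (k + 1), i.val ≤ k := fun i => i.is_le
    ext i j
    change _ ↔ Near (fun i : ℕ => w i) i.val j.val
    rw [near_natCast_iff, ← h.adj_iff_near (abs_lt.2 ⟨by grind, by grind⟩), ← hπ _ i.is_le,
      ← hπ _ j.is_le, hφ _ i.is_le, hφ _ j.is_le, φ.map_rel_iff]
  obtain ⟨d, hd⟩ := h.exists_shift_of_injective (p := fun i => φ (Fin.ofNat (k + 1) i))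
    (fun j hj => by
      simp only [hφ _ hj.le, hφ (j + 1) hj, Linked, φ.map_rel_iff]
      exact hQ.consec ⟨j, hj⟩)
    (fun i j hi hj hij => by
      simpa only [hφ _ hi, hφ _ hj, φ.injective.eq_iff, Fin.ext_iff] using hij)
  rcases hd with hd | hd
  · exact ⟨_, hQw (h.shift d) hd, isCyclicFactor_factor h.periodic d⟩
  · refine ⟨_, hQw (h.reflect.shift d) hd, fun c => ?_⟩
    have hbar := (isCyclicFactor_factor h.periodic (-d - k) c).barWord
    rwa [barWord_factor, show -(-d - (k : ℤ)) - k = d by ring] at hbar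

end IsUnrolling

/-! ### Walks that follow a pattern -/

/-- A step along an arc in the given direction, where `true` is forward. -/
def Step {α : Type*} (r : α → α → Prop) : Bool → α → α → Prop
  | true, x, y => r x y
  | false, x, y => r y x

/-- There is a walk from `x` to `y` along arcs with the directions given by the pattern. -/
def Walk {α : Type*} (r : α → α → Prop) : List Bool → α → α → Prop
  | [], x, y => x = y
  | c :: p, x, y => ∃ z, Step r c x z ∧ Walk r p z y

theorem step_refl {α : Type*} {r : α → α → Prop} (hr : ∀ x, r x x) : ∀ c x, Step r c x x
  | true, x => hr x
  | false, x => hr x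

theorem Step.map {α β : Type*} {r : α → α → Prop} {s : β → β → Prop} {f : α → β}
    (hf : ∀ x y, r x y → s (f x) (f y)) : ∀ {c : Bool} {x y : α}, Step r c x y →
    Step s c (f x) (f y)
  | true, _, _, h => hf _ _ h
  | false, _, _, h => hf _ _ h

theorem Walk.map {α β : Type*} {r : α → α → Prop} {s : β → β → Prop} {f : α → β}
    (hf : ∀ x y, r x y → s (f x) (f y)) : ∀ {p : List Bool} {x y : α}, Walk r p x y →
    Walk s p (f x) (f y)
  | [], _, _, h => congrArg f h
  | _ :: _, _, _, ⟨z, hxz, hzy⟩ => ⟨f z, hxz.map hf, hzy.map hf⟩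

theorem step_pi {ι : Type*} {α : ι → Type*} {r : ∀ i, α i → α i → Prop} :
    ∀ {c : Bool} {x y : ∀ i, α i}, (∀ i, Step (r i) c (x i) (y i)) →
      Step (fun x y => ∀ i, r i (x i) (y i)) c x y
  | true, _, _, h => h
  | false, _, _, h => h

theorem walk_pi {ι : Type*} {α : ι → Type*} {r : ∀ i, α i → α i → Prop} :
    ∀ {p : List Bool} {x y : ∀ i, α i}, (∀ i, Walk (r i) p (x i) (y i)) →
      Walk (fun x y => ∀ i, r i (x i) (y i)) p x y
  | [], _, _, h => funext h
  | _ :: _, _, _, h => by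
    choose z hxz hzy using h
    exact ⟨z, step_pi hxz, walk_pi hzy⟩

theorem Contains.walk {α : Type*} {r : α → α → Prop} (hr : ∀ x, r x x) {W : List Letter}
    {p : List Bool} (h : Contains W p) {v : ℕ → α}
    (hv : ∀ i (hi : i < W.length) c, W[i].allows c → Step r c (v i) (v (i + 1))) :
    Walk r p (v 0) (v W.length) := by
  induction p generalizing W v with
  | nil =>
    cases h
    rfl
  | cons c p ih =>
    cases h with
    | nil => exact ⟨_, step_refl hr c _, ih .nil nofun⟩
    | cons hl h =>
      exact ⟨_, hv 0 (by simp) c hl, ih h (v := fun i => v (i + 1)) fun i hi =>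
        hv (i + 1) (by simpa using hi)⟩
    | cons_right h => exact ⟨_, step_refl hr c _, ih h hv⟩

theorem step_near_iff {α : Type*} [Add α] [One α] {u : α → Letter} {c : Bool} {i j : α} :
    Step (Near u) c i j ↔
      i = j ∨ (j = i + 1 ∧ (u i).allows c) ∨ (i = j + 1 ∧ (u j).allows (!c)) := by
  cases c
  · simp only [Step, Near, Bool.not_false]
    rw [eq_comm, or_comm (b := j = i + 1 ∧ _)]
  · rfl

theorem range_eq_append {x y k : ℕ} (hxy : x ≤ y) (hyk : y ≤ k) (u : ℕ → Letter) :
    ∃ A B, (List.range k).map u = A ++ (List.range (y - x)).map (fun i => u (x + i)) ++ B := by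
  obtain ⟨d, rfl⟩ := Nat.exists_eq_add_of_le hxy
  obtain ⟨e, rfl⟩ := Nat.exists_eq_add_of_le hyk
  rw [List.range_add, List.range_add, List.map_append, List.map_append, List.map_map,
    Nat.add_sub_cancel_left]
  exact ⟨_, _, rfl⟩

theorem walk_near {u : ℕ → Letter} {k : ℕ} {p : List Bool}
    (h1 : Contains ((List.range k).map u) p) (h2 : Contains (barWord ((List.range k).map u)) p)
    {x y : ℕ} (hx : x ≤ k) (hy : y ≤ k) : Walk (Near u) p x y := by
  have hrefl : ∀ x, Near u x x := fun _ => Or.inl rfl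
  rcases le_total x y with hxy | hxy
  · obtain ⟨A, B, hAB⟩ := range_eq_append hxy hy u
    rw [hAB] at h1
    have hwalk := h1.of_append_append.walk hrefl (v := fun i => x + i) fun i hi c hc =>
      step_near_iff.2 (Or.inr (Or.inl ⟨rfl, by simpa using hc⟩))
    simpa [hxy] using hwalk
  · obtain ⟨A, B, hAB⟩ := range_eq_append hxy hx u
    rw [hAB, barWord_append, barWord_append, ← List.append_assoc] at h2
    have hwalk := h2.of_append_append.walk hrefl (v := fun i => x - i) fun i hi c hc => by
      simp only [length_barWord, List.length_map, List.length_range] at hi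
      refine step_near_iff.2 (Or.inr (Or.inr ⟨by lia, ?_⟩))
      simp only [barWord, List.getElem_reverse, List.getElem_map, List.length_map,
        List.length_range, List.getElem_range, Letter.allows_bar] at hc
      rwa [show y + (x - y - 1 - i) = x - (i + 1) by lia] at hc
    simpa [Nat.sub_sub_self hxy] using hwalk

theorem contains_factor_of_walk {w : ℤ → Letter} {p : List Bool} {s t m : ℤ} {k : ℕ}
    (h : Walk (Near w) p s t) (hs : s ≤ m) (ht : m + k ≤ t) : Contains (factor w m k) p := by
  induction p generalizing s m k with
  | nil =>
    have hst : s = t := h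
    obtain rfl : k = 0 := by lia
    exact .nil
  | cons c p ih =>
    obtain ⟨z, hsz, hzt⟩ := h
    cases k with
    | zero => exact .nil
    | succ k =>
      by_cases hz : z ≤ m
      · exact (ih hzt hz ht).mono (List.sublist_cons_self _ _)
      rw [step_near_iff] at hsz
      have hmz : s = m ∧ z = m + 1 := by lia
      obtain ⟨rfl, rfl⟩ := hmz
      rw [factor_succ]
      refine .cons ?_ (ih hzt le_rfl (by lia))
      simpa [add_assoc] using hsz

/-! ### Lifting homomorphisms to the unrolled cycle -/

/-- `F` lifts `f` along `π` and maps related points to equal or consecutive positions. -/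
structure IsLift {α V : Type*} (π : ℤ → V) (R : α → α → Prop) (f : α → V) (F : α → ℤ) : Prop where
  eq : ∀ x, π (F x) = f x
  abs_sub_le : ∀ x y, R x y → |F y - F x| ≤ 1

/-- Every homomorphism to the cycle `G` lifts to the unrolled cycle. -/
def Liftable {α V : Type*} (G : Digraph V) (π : ℤ → V) (R : α → α → Prop) : Prop :=
  ∀ f : α → V, (∀ x y, R x y → G.Adj (f x) (f y)) → ∃ F, IsLift π R f F

namespace IsUnrolling

variable {V : Type*} {G : Digraph V} {n : ℕ} {π : ℤ → V} {w : ℤ → Letter}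

/-- This fails for `n = 3`, where all vertices are linked. -/
theorem abs_sub_le_one (h : IsUnrolling G n π w) (hn : 4 ≤ n) {i j : ℤ}
    (hl : Linked G (π i) (π j)) (hij : |j - i| ≤ 2) : |j - i| ≤ 1 := by
  obtain ⟨j', hj', hπ⟩ := h.exists_of_linked hl
  rw [abs_le] at hij
  have hj := abs_le.1 hj'
  rwa [← h.eq_of_abs_sub_lt hπ (abs_lt.2 ⟨by lia, by lia⟩)]

theorem exists_lift_path (h : IsUnrolling G n π w) {p : ℕ → V}
    (hp : ∀ t, Linked G (p t) (p (t + 1))) {c : ℤ} (hc : π c = p 0) :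
    ∃ P : ℕ → ℤ, P 0 = c ∧ ∀ t, π (P t) = p t ∧ |P (t + 1) - P t| ≤ 1 := by
  have hnext : ∀ i t, ∃ j, π i = p t → |j - i| ≤ 1 ∧ π j = p (t + 1) := fun i t => by
    by_cases hi : π i = p t
    · obtain ⟨j, hj⟩ := h.exists_of_linked (hi ▸ hp t)
      exact ⟨j, fun _ => hj⟩
    · exact ⟨0, fun h => absurd h hi⟩
  choose next hnext using hnext
  have hP : ∀ t, π (Nat.rec c (fun t i => next i t) t : ℤ) = p t := fun t => by
    induction t with
    | zero => exact hc
    | succ t ih => exact (hnext _ t ih).2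
  exact ⟨fun t => Nat.rec c (fun t i => next i t) t, rfl, fun t => ⟨hP t, (hnext _ t (hP t)).1⟩⟩

theorem isLift_of_isLift (h : IsUnrolling G n π w) (hn : 4 ≤ n) {α : Type*} {R : α → α → Prop}
    {f₀ f₁ : α → V} {F₀ F₁ : α → ℤ} (h₀ : IsLift π R f₀ F₀) (h₁ : ∀ x, π (F₁ x) = f₁ x)
    (hF : ∀ x, |F₁ x - F₀ x| ≤ 1) (hf₁ : ∀ x y, R x y → G.Adj (f₁ x) (f₁ y))
    (hdiag : ∀ x y, R x y → Linked G (f₀ x) (f₁ y) ∨ Linked G (f₁ x) (f₀ y)) :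
    IsLift π R f₁ F₁ := by
  refine ⟨h₁, fun x y hxy => ?_⟩
  have hx := abs_le.1 (hF x)
  have hy := abs_le.1 (hF y)
  have hxy₀ := abs_le.1 (h₀.abs_sub_le x y hxy)
  have hxy₁ : Linked G (π (F₁ x)) (π (F₁ y)) := Or.inl (by simpa only [h₁] using hf₁ x y hxy)
  refine h.abs_sub_le_one hn hxy₁ (abs_le.2 ?_)
  rcases hdiag x y hxy with hd | hd <;> rw [← h₁, ← h₀.eq] at hd
  · have := abs_le.1 (h.abs_sub_le_one hn hd (abs_le.2 ⟨by lia, by lia⟩))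
    lia
  · have := abs_le.1 (h.abs_sub_le_one hn hd (abs_le.2 ⟨by lia, by lia⟩))
    lia

theorem near_succ_or_succ_near (u : ℕ → Letter) (t : ℕ) : Near u t (t + 1) ∨ Near u (t + 1) t := by
  rw [near_succ_iff, succ_near_iff]
  cases u t <;> simp [Letter.allows]

theorem liftable_prod (h : IsUnrolling G n π w) (hn : 4 ≤ n) {α : Type*} {R : α → α → Prop}
    (hR : ∀ x, R x x) (hL : Liftable G π R) (u : ℕ → Letter) :
    Liftable G π fun p q : α × ℕ => R p.1 q.1 ∧ Near u p.2 q.2 := by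
  intro f hf
  obtain ⟨F₀, h₀⟩ := hL (fun x => f (x, 0)) fun x y hxy => hf _ _ ⟨hxy, Or.inl rfl⟩
  have hdir : ∀ t, (∀ x y, R x y → Linked G (f (x, t)) (f (y, t + 1))) ∨
      ∀ x y, R x y → Linked G (f (x, t + 1)) (f (y, t)) := fun t =>
    (near_succ_or_succ_near u t).imp (fun ht x y hxy => Or.inl (hf _ _ ⟨hxy, ht⟩))
      fun ht x y hxy => Or.inl (hf _ _ ⟨hxy, ht⟩)
  have hpath : ∀ x t, Linked G (f (x, t)) (f (x, t + 1)) := fun x t =>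
    (hdir t).elim (fun h => h x x (hR x)) fun h => (h x x (hR x)).symm
  choose F hF₀ hF using fun x => h.exists_lift_path (hpath x) (h₀.eq x)
  have hlift : ∀ t, IsLift π R (fun x => f (x, t)) fun x => F x t := by
    intro t
    induction t with
    | zero => simpa only [hF₀] using h₀
    | succ t ih =>
      exact h.isLift_of_isLift hn ih (fun x => (hF x _).1) (fun x => (hF x t).2)
        (fun x y hxy => hf _ _ ⟨hxy, Or.inl rfl⟩) fun x y hxy =>
          (hdir t).imp (fun h => h x y hxy) fun h => h x y hxy
  refine ⟨fun p => F p.1 p.2, fun p => (hF p.1 p.2).1, ?_⟩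
  rintro ⟨x, s⟩ ⟨y, t⟩ ⟨hxy, hst⟩
  have hlink : Linked G (π (F x s)) (π (F y t)) := by
    rw [(hF x s).1, (hF y t).1]
    exact Or.inl (hf _ _ ⟨hxy, hst⟩)
  refine h.abs_sub_le_one hn hlink (abs_le.2 ?_)
  have hxs := abs_le.1 ((hlift s).abs_sub_le x y hxy)
  dsimp only at hst hxs
  rcases hst with rfl | ⟨rfl, -⟩ | ⟨rfl, -⟩
  · lia
  · have := abs_le.1 (hF y s).2
    lia
  · have := abs_le.1 (hF y t).2
    lia

theorem liftable_pi (h : IsUnrolling G n π w) (hn : 4 ≤ n) : ∀ {m : ℕ} (u : Fin m → ℕ → Letter),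
    Liftable G π fun x y : Fin m → ℕ => ∀ i, Near (u i) (x i) (y i)
  | 0, u => fun f _ => by
    obtain ⟨i, hi⟩ := h.surjective (f 0)
    exact ⟨fun _ => i, fun x => by rw [hi, Subsingleton.elim x 0], by simp⟩
  | m + 1, u => fun f hf => by
    obtain ⟨F, hF⟩ := h.liftable_prod hn (fun x i => Or.inl rfl)
      (h.liftable_pi hn fun i => u i.succ) (u 0) (fun p => f (Fin.cons p.2 p.1)) fun p q hpq =>
        hf _ _ (Fin.forall_fin_succ.2 (by simpa using hpq.symm))
    refine ⟨fun x => F (Fin.tail x, x 0), fun x => ?_, fun x y hxy => ?_⟩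
    · rw [hF.eq, Fin.cons_self_tail]
    · exact hF.abs_sub_le _ _ ⟨fun i => hxy i.succ, hxy 0⟩

theorem near_of_isLift (h : IsUnrolling G n π w) (hn : 4 ≤ n) {α : Type*} {R : α → α → Prop}
    {f : α → V} (hf : ∀ x y, R x y → G.Adj (f x) (f y)) {F : α → ℤ} (hF : IsLift π R f F) {x y : α}
    (hxy : R x y) : Near w (F x) (F y) := by
  have hle := abs_le.1 (hF.abs_sub_le x y hxy)
  rw [← h.adj_iff_near (abs_lt.2 ⟨by lia, by lia⟩), hF.eq, hF.eq]
  exact hf x y hxy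

theorem exists_far (h : IsUnrolling G n π w) {α : Type*} [Nonempty α] {F : α → ℤ}
    (hF : Function.Surjective fun x => π (F x)) : ∃ x y, F x + (n - 1) ≤ F y := by
  by_contra! hc
  obtain ⟨x₀⟩ := ‹Nonempty α›
  obtain ⟨_, ⟨x, rfl⟩, hmin⟩ := Int.exists_least_of_bdd (P := fun z => ∃ x, F x = z)
    ⟨F x₀ - (n - 1), by
      rintro _ ⟨x, rfl⟩
      linarith [hc x x₀]⟩ ⟨_, x₀, rfl⟩
  obtain ⟨y, hy⟩ := hF (π (F x + (n - 1)))
  have hxy := hmin _ ⟨y, rfl⟩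
  have hyx := hc x y
  have := h.eq_of_abs_sub_lt hy (abs_lt.2 ⟨by lia, by lia⟩)
  lia

end IsUnrolling

theorem Near.min {u : ℕ → Letter} {i j : ℕ} (h : Near u i j) (k : ℕ) :
    Near u (min i k) (min j k) := by
  rcases h with rfl | ⟨rfl, h⟩ | ⟨rfl, h⟩
  · exact Or.inl rfl
  · rcases lt_or_ge i k with hk | hk
    · exact Or.inr (Or.inl ⟨by lia, by rwa [min_eq_left hk.le]⟩)
    · exact Or.inl (by lia)
  · rcases lt_or_ge j k with hk | hk
    · exact Or.inr (Or.inr ⟨by lia, by rwa [min_eq_left hk.le]⟩)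
    · exact Or.inl (by lia)

theorem exists_isPath_pathWord_eq (U : List Letter) :
    ∃ (s : ℕ) (S : Digraph (Fin (s + 1))), IsPath S ∧ pathWord S = U := by
  refine ⟨_, pathOfFn (fun i => U.getD i .star) U.length, isPath_pathOfFn _ _, ?_⟩
  rw [pathWord_pathOfFn]
  refine List.ext_getElem (by simp) fun i h1 h2 => ?_
  simp [h2]

theorem exists_stars_append_of_length_dirs : ∀ {W : List Letter}, (dirs W).length = 1 →
    ∃ a b d, W = stars a ++ .ofBool b :: stars d
  | [], h => by simp at h
  | l :: W, h => by
    rcases l.eq_star_or_ofBool with rfl | ⟨b, rfl⟩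
    · rw [dirs_star_cons] at h
      obtain ⟨a, b, d, rfl⟩ := exists_stars_append_of_length_dirs h
      exact ⟨a + 1, b, d, rfl⟩
    · simp only [dirs_ofBool_cons, List.length_cons, Nat.add_eq_right,
        List.length_eq_zero_iff] at h
      exact ⟨0, b, W.length, by rw [← eq_stars_of_dirs_eq_nil h]; rfl⟩

namespace IsUnrolling

variable {n : ℕ} {G : Digraph (Fin n)} {π : ℤ → Fin n} {w : ℤ → Letter}

theorem exists_lift_of_not_pathCondition (h : IsUnrolling G n π w) (hn : 4 ≤ n)
    (hG : ¬ PathCondition G) :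
    ∃ (m : ℕ) (u : Fin m → ℕ → Letter) (F : (Fin m → ℕ) → ℤ),
      (∀ i c, IsCyclicFactor ((List.range (n - 2)).map (u i)) (factor w c n)) ∧
      (∀ x y, (∀ i, Near (u i) (x i) (y i)) → Near w (F x) (F y)) ∧
      ∃ x y, (∀ i, x i ≤ n - 2 ∧ y i ≤ n - 2) ∧ F x + (n - 1) ≤ F y := by
  obtain ⟨m, Q, -, hQ, f, hf⟩ := not_not.1 hG
  choose u hu huG using fun i => h.exists_letters_of_embeds (k := n - 2) (by lia) (hQ i).1 (hQ i).2
  let clamp (x : Fin m → ℕ) (i : Fin m) : Fin (n - 2 + 1) := ⟨min (x i) (n - 2), by lia⟩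
  have hclamp : ∀ x y : Fin m → ℕ, (∀ i, Near (u i) (x i) (y i)) →
      G.Adj (f (clamp x)) (f (clamp y)) := fun x y hxy => f.map_rel fun i => by
    rw [hu i]
    exact (hxy i).min (n - 2)
  obtain ⟨F, hF⟩ := h.liftable_pi hn u (fun x => f (clamp x)) hclamp
  have hsurj : Function.Surjective fun x : ∀ _ : Fin m, Fin (n - 2 + 1) =>
      π (F fun i => (x i).val) := fun z => by
    obtain ⟨x, rfl⟩ := hf z
    have hx : clamp (fun i => (x i).val) = x := funext fun i => Fin.ext (min_eq_left (x i).is_le)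
    exact ⟨x, by simp only [hF.eq, hx]⟩
  obtain ⟨x, y, hxy⟩ := h.exists_far hsurj
  exact ⟨m, u, F, huG, fun _ _ => h.near_of_isLift hn hclamp hF, _, _,
    fun i => ⟨(x i).is_le, (y i).is_le⟩, hxy⟩

theorem exists_isForcedFactor (h : IsUnrolling G n π w) (hn : 4 ≤ n) (hG : ¬ PathCondition G) :
    ∃ R y c, R ≠ [] ∧ IsForcedFactor R y ∧ factor w c n = R ++ [y] := by
  obtain ⟨m, u, F, hu, hF, x, y, hle, hxy⟩ := h.exists_lift_of_not_pathCondition hn hG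
  have hsplit : factor w (F x) n = factor w (F x) (n - 1) ++ [w (F x + (n - 1 : ℕ))] := by
    rw [← factor_succ', Nat.sub_add_cancel (by lia)]
  refine ⟨_, _, F x, List.ne_nil_of_length_pos (by simp; lia), fun p hp => ?_, hsplit⟩
  rw [← hsplit] at hp
  have hwalk : ∀ i, Walk (Near (u i)) p (x i) (y i) := fun i =>
    walk_near (hp _ (hu i _)) (hp _ (hu i _).barWord) (hle i).1 (hle i).2
  exact contains_factor_of_walk ((walk_pi hwalk).map hF) le_rfl (by lia)

theorem almostSymmetric_of_length_dirs (h : IsUnrolling G n π w) {c : ℤ}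
    (hd : (dirs (factor w c n)).length = 1) : AlmostSymmetric G := by
  obtain ⟨a, b, d, hW⟩ := exists_stars_append_of_length_dirs hd
  have hlen := congrArg List.length hW
  simp only [length_factor, List.length_append, List.length_cons, List.length_replicate] at hlen
  have hrot := List.isRotated_append (l := stars d) (l' := stars a ++ [.ofBool b])
  rw [List.append_assoc, List.singleton_append, ← hW, ← List.append_assoc,
    List.replicate_append_replicate, show d + a = n - 1 by lia] at hrot
  obtain ⟨c', hc'⟩ := eq_factor_of_isRotated h.periodic hrot
  exact h.almostSymmetric_iff.2 ⟨c', b, hc'.symm⟩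

theorem isomorphic_cycleOfWord (h : IsUnrolling G n π w) {W : List Letter} {c : ℤ}
    (hW : W ~r factor w c n) : Isomorphic G (cycleOfWord W) := by
  obtain ⟨π₁, w₁, h₁, hW₁⟩ := h.exists_isUnrolling_of_isRotated hW
  obtain rfl : n = W.length := by rw [hW₁, length_factor]
  obtain ⟨π₂, w₂, h₂, hW₂⟩ := isUnrolling_cycleOfWord h.three_le
  obtain rfl : w₁ = w₂ := h₁.ext_letters h₂.periodic fun i hi => by
    have hf := hW₁.symm.trans (eq_factor_of_get hW₂)
    simpa using List.map_inj_left.1 hf i (List.mem_range.2 hi)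
  exact h₁.isomorphic h₂

theorem hasSpecialForm (h : IsUnrolling G n π w) (hn : 4 ≤ n) (hG : ¬ PathCondition G) :
    HasSpecialForm G := by
  obtain ⟨R, y, c, hne, hR, hc⟩ := h.exists_isForcedFactor hn hG
  rcases hR.length_dirs_eq_one_or_exists_root hne with hd | ⟨b, U, k, rfl, hk, hU, rfl⟩
  · exact Or.inl (h.almostSymmetric_of_length_dirs (hc ▸ hd))
  obtain ⟨s, S, hS, rfl⟩ := exists_isPath_pathWord_eq U
  refine Or.inr ⟨_, S, k, hS, hU, hk, ?_⟩
  cases b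
  · refine h.reflect.isomorphic_cycleOfWord (c := -c - n) ?_
    rw [← barWord_factor, hc, barWord_append, barWord_powWord_append hU]
    exact List.isRotated_append
  · refine h.isomorphic_cycleOfWord (c := c) ?_
    rw [hc]
    rfl

end IsUnrolling

end CycleWords

theorem theorem4p2 (n : ℕ) (hn : 3 ≤ n) (G : Digraph (Fin n)) (hG : CycleWords.IsCycle G) :
    (4 ≤ n → (¬ CycleWords.PathCondition G ↔ CycleWords.HasSpecialForm G)) ∧
      (CycleWords.HasSpecialForm G → ¬ CycleWords.PathCondition G) := by
  have hif : CycleWords.HasSpecialForm G → ¬ CycleWords.PathCondition G :=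
    fun h => h.not_pathCondition hn hG
  obtain ⟨π, w, hw⟩ := hG.exists_isUnrolling hn
  exact ⟨fun h4 => ⟨hw.hasSpecialForm h4, hif⟩, hif⟩
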